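/- Fix countably infinite sets of concept names, role names and constants. A role is a role name $R$ or an inverse $R^-$ of a role name. $\mathcal{ALCI}$-concepts are built from concept names and $\top$ (which uses no relation symbol) by $\neg C$, $C\sqcap D$ and $\exists R.C$ with $R$ a role, with the usual semantics $C^{\mathfrak A}$ in relational structures $\mathfrak A$ (non-empty domain, every constant $c$ interpreted by an element $c^{\mathfrak A}$, distinct constants possibly by the same element). An $\mathcal{ALCI}$-KB $\mathcal K=(\mathcal O,\mathcal D)$ consists of a finite set $\mathcal O$ of concept inclusions $C\sqsubseteq D$ and a finite set $\mathcal D$ of ground atoms $A(c)$, $R(c,c')$; a model of $\mathcal K$ is a structure satisfying all of them. Let $\mathrm{cons}(\mathcal D)$ be the set of constants in $\mathcal D$ and $\mathrm{sig}(\cdot)$ the set of concept and role names that occur in an object. A labeled $\mathcal{ALCI}$-KB $(\mathcal K,P,N)$ consists of such a $\mathcal K$ and non-empty sets $P,N\subseteq\mathrm{cons}(\mathcal D)$. It is non-projectively $\mathcal{ALCI}$-separable if there is an $\mathcal{ALCI}$-concept $C$ with $\mathrm{sig}(C)\subseteq\mathrm{sig}(\mathcal K)$ such that $a^{\mathfrak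 A}\in C^{\mathfrak A}$ in every model $\mathfrak A$ of $\mathcal K$, for all $a\in P$, and for each $b\in N$ there is a model $\mathfrak A$ of $\mathcal K$ with $b^{\mathfrak A}\notin C^{\mathfrak A}$. Let $\mathcal D_{\mathrm{con}(a)}$ be the restriction of $\mathcal D$ to the constants reachable from $a$ in the Gaifman graph of $\mathcal D$ (constants are adjacent if they occur together in an atom), and write $\mathcal D_{\mathrm{con}(a)},a\to\mathfrak A,d$ if there is a map $h:\mathrm{cons}(\mathcal D_{\mathrm{con}(a)})\to\mathrm{dom}(\mathfrak A)$ with $h(a)=d$, $h(c)\in A^{\mathfrak A}$ for all $A(c)\in\mathcal D_{\mathrm{con}(a)}$ and $(h(c),h(c'))\in R^{\mathfrak A}$ for all $R(c,c')\in\mathcal D_{\mathrm{con}(a)}$. Let $\mathrm{cl}(\mathcal K)$ be the least set of concepts that contains the concepts in $\mathcal O$, the concept names in $\mathcal D$, and $\exists R.\top$, $\exists R^-.\top$ for all role names $R\in\mathrm{sig}(\mathcal K)$, and that is closed under subconcepts and under adding $\neg C$ for members $C$ not themselves of the form $\neg D$. Put $\mathrm{tp}_{\mathcal K}(\mathfrak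 A,d)=\{C\in\mathrm{cl}(\mathcal K)\mid d\in C^{\mathfrak A}\}$; a $\mathcal K$-type is a set of this form for a model $\mathfrak A$ of $\mathcal K$ and $d\in\mathrm{dom}(\mathfrak A)$. A $\mathcal K$-type $t$ is connected if $\exists R.\top\in t$ for some role $R$. It is $\mathcal{ALCI}$-complete if for all models $\mathfrak A_1,\mathfrak A_2$ of $\mathcal K$ and elements $b_1,b_2$ with $\mathrm{tp}_{\mathcal K}(\mathfrak A_1,b_1)=t=\mathrm{tp}_{\mathcal K}(\mathfrak A_2,b_2)$ there is a $\mathrm{sig}(\mathcal K)$-bisimulation between $\mathfrak A_1$ and $\mathfrak A_2$ containing $(b_1,b_2)$; here a $\Sigma$-bisimulation is a relation whose pairs agree on all concept names in $\Sigma$ and that satisfies the forth and back conditions for all roles over $\Sigma$, inverse roles included. It is realizable in $\mathcal K,a$ if $\mathrm{tp}_{\mathcal K}(\mathfrak B,a^{\mathfrak B})=t$ for some model $\mathfrak B$ of $\mathcal K$. **Theorem.** A labeled $\mathcal{ALCI}$-KB $(\mathcal K,P,\{b\})$, $\mathcal K=(\mathcal O,\mathcal D)$, is non-projectively $\mathcal{ALCI}$-separable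 if and only if there exists a model $\mathfrak A$ of $\mathcal K$ such that for all $a\in P$: 1. $\mathcal D_{\mathrm{con}(a)},a\not\to\mathfrak A,b^{\mathfrak A}$; and 2. if $\mathrm{tp}_{\mathcal K}(\mathfrak A,b^{\mathfrak A})$ is connected and $\mathcal{ALCI}$-complete, then $\mathrm{tp}_{\mathcal K}(\mathfrak A,b^{\mathfrak A})$ is not realizable in $\mathcal K,a$. -/

import Mathlib

universe u v

namespace ALCI

/-! ### Syntax -/

/-- Concept names (unary relation symbols): a countably infinite set. -/
abbrev ConceptName := ℕ

/-- Role names (binary relation symbols): a countably infinite set. -/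
abbrev RoleName := ℕ

/-- Constants: a countably infinite set. -/
abbrev Const := ℕ

/-- Relation symbols of arity one and two, the only ones that can occur in an ALCI knowledge
base; a signature is a set of these. -/
inductive Symbol where
  | concept (A : ConceptName)
  | role (R : RoleName)

/-- Roles: a role name or the inverse of a role name. -/
inductive Role where
  | name (R : RoleName)
  | inv (R : RoleName)

/-- The relation symbol used by a role. -/
def Role.symbol : Role → Symbol
  | .name R => .role R
  | .inv R => .role R

/-- ALCI concepts. The top concept is a constructor of its own, so that its signature is empty. -/
inductive Concept where
  | top
  | name (A : ConceptName)
  | neg (C : Concept)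
  | and (C D : Concept)
  | ex (R : Role) (C : Concept)

/-- The relation symbols that occur in a concept. -/
def Concept.sig : Concept → Set Symbol
  | .top => ∅
  | .name A => {.concept A}
  | .neg C => C.sig
  | .and C D => C.sig ∪ D.sig
  | .ex R C => {R.symbol} ∪ C.sig

/-- A concept inclusion `lhs ⊑ rhs`. -/
structure ConceptInclusion where
  lhs : Concept
  rhs : Concept

/-- An ALCI ontology: a finite set of concept inclusions. -/
abbrev Ontology := Finset ConceptInclusion

/-- Ground atoms `A(a)` and `R(a, b)`. -/
inductive GroundAtom where
  | concept (A : ConceptName) (a : Const)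
  | role (R : RoleName) (a b : Const)

/-- The constants of a ground atom. -/
def GroundAtom.cons : GroundAtom → Set Const
  | .concept _ a => {a}
  | .role _ a b => {a, b}

/-- The relation symbol of a ground atom. -/
def GroundAtom.symbol : GroundAtom → Symbol
  | .concept A _ => .concept A
  | .role R _ _ => .role R

/-- A database over unary and binary relation symbols: a finite set of ground atoms. -/
abbrev Database := Finset GroundAtom

/-- The set `cons(D)` of constants that occur in `D`. -/
def Database.cons (D : Database) : Set Const := {c | ∃ α ∈ D, c ∈ α.cons}

/-- The Gaifman graph of a database: distinct constants are adjacent iff they occur together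
in some ground atom of the database. -/
def Database.gaifman (D : Database) : SimpleGraph Const where
  Adj c d := c ≠ d ∧ ∃ α ∈ D, c ∈ α.cons ∧ d ∈ α.cons
  symm := ⟨fun _ _ h => ⟨h.1.symm, h.2.imp fun _ hα => ⟨hα.1, hα.2.2, hα.2.1⟩⟩⟩
  loopless := ⟨fun _ h => h.1 rfl⟩

open Classical in
/-- `D_con(a)`: the restriction of `D` to the constants reachable from `a` in the Gaifman
graph of `D`. -/
noncomputable def Database.con (D : Database) (a : Const) : Database :=
  Finset.filter (fun α => ∀ c ∈ α.cons, D.gaifman.Reachable a c) D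

/-- An ALCI knowledge base. -/
structure KB where
  ontology : Ontology
  database : Database

/-- The relation symbols that occur in a knowledge base. -/
def KB.sig (K : KB) : Set Symbol :=
  {s | (∃ I ∈ K.ontology, s ∈ I.lhs.sig ∪ I.rhs.sig) ∨ ∃ α ∈ K.database, s = α.symbol}

/-! ### Semantics -/

/-- Relational structures without constant symbols, restricted to unary and binary symbols. -/
structure RelStr where
  Dom : Type u
  conc : ConceptName → Set Dom
  role : RoleName → Dom → Dom → Prop

/-- Structures in which knowledge bases are interpreted. Constants need not denote distinct
elements. The domain is non-empty because it interprets the constants. -/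
structure Struc extends RelStr.{u} where
  const : Const → Dom

/-- The interpretation of roles. -/
def RelStr.roleExt (A : RelStr.{u}) : Role → A.Dom → A.Dom → Prop
  | .name R, d, e => A.role R d e
  | .inv R, d, e => A.role R e d

/-- The extension of a concept in a structure. -/
def Concept.ext (A : RelStr.{u}) : Concept → Set A.Dom
  | .top => Set.univ
  | .name N => A.conc N
  | .neg C => (C.ext A)ᶜ
  | .and C D => C.ext A ∩ D.ext A
  | .ex R C => {d | ∃ e, A.roleExt R d e ∧ e ∈ C.ext A}

/-- Truth of a ground atom in a structure. -/
def Struc.satAtom (A : Struc.{u}) : GroundAtom → Prop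
  | .concept N a => A.const a ∈ A.conc N
  | .role R a b => A.role R (A.const a) (A.const b)

/-- `A` is a model of `K`. -/
def Struc.IsModel (A : Struc.{u}) (K : KB) : Prop :=
  (∀ I ∈ K.ontology, I.lhs.ext A.toRelStr ⊆ I.rhs.ext A.toRelStr) ∧
    ∀ α ∈ K.database, A.satAtom α

/-- `K ⊨ C(a)`. -/
def KB.Entails (K : KB) (C : Concept) (a : Const) : Prop :=
  ∀ A : Struc.{u}, A.IsModel K → A.const a ∈ C.ext A.toRelStr

/-! ### Homomorphisms -/

/-- Homomorphisms between relational structures; constants need not be preserved. -/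
structure RelStr.IsHom (A : RelStr.{u}) (B : RelStr.{v}) (h : A.Dom → B.Dom) : Prop where
  conc : ∀ N d, d ∈ A.conc N → h d ∈ B.conc N
  role : ∀ R d e, A.role R d e → B.role R (h d) (h e)

/-- The structure given by a database; its domain is the set of constants of the database. -/
def Database.toRelStr (D : Database) : RelStr.{0} where
  Dom := D.cons
  conc N := {c | GroundAtom.concept N c ∈ D}
  role R c d := GroundAtom.role R c d ∈ D

/-- `D, a → A, d`: there is a homomorphism from `D` to `A` that maps `a` to `d`. -/
def Database.HomTo (D : Database) (a : Const) (A : RelStr.{u}) (d : A.Dom) : Prop :=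
  ∃ (ha : a ∈ D.cons) (h : D.toRelStr.Dom → A.Dom), D.toRelStr.IsHom A h ∧ h ⟨a, ha⟩ = d

/-! ### Separability -/

/-- A labeled ALCI knowledge base `(K, P, N)`. -/
structure LabeledKB where
  kb : KB
  pos : Set Const
  neg : Set Const
  pos_subset : pos ⊆ kb.database.cons
  neg_subset : neg ⊆ kb.database.cons
  pos_nonempty : pos.Nonempty
  neg_nonempty : neg.Nonempty

/-- The concept `C` (weakly) separates the labeled knowledge base. -/
def LabeledKB.SeparatedBy (L : LabeledKB) (C : Concept) : Prop :=
  (∀ a ∈ L.pos, KB.Entails.{u} L.kb C a) ∧ ∀ b ∈ L.neg, ¬ KB.Entails.{u} L.kb C b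

/-- Non-projective ALCI-separability: only symbols of the knowledge base may be used. -/
def LabeledKB.NonProjectivelySeparable (L : LabeledKB) : Prop :=
  ∃ C : Concept, C.sig ⊆ L.kb.sig ∧ LabeledKB.SeparatedBy.{u} L C

/-! ### Bisimulations -/

/-- `S`-bisimulations between two structures, where `S` is a signature. -/
structure IsBisim (S : Set Symbol) (A : RelStr.{u}) (B : RelStr.{v})
    (Z : A.Dom → B.Dom → Prop) : Prop where
  atom : ∀ N, Symbol.concept N ∈ S → ∀ d e, Z d e → (d ∈ A.conc N ↔ e ∈ B.conc N)
  forth : ∀ R : Role, R.symbol ∈ S → ∀ d e d', Z d e → A.roleExt R d d' →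
    ∃ e', B.roleExt R e e' ∧ Z d' e'
  back : ∀ R : Role, R.symbol ∈ S → ∀ d e e', Z d e → B.roleExt R e e' →
    ∃ d', A.roleExt R d d' ∧ Z d' e'

/-- `A, d` and `B, e` are `S`-bisimilar. -/
def Bisimilar (S : Set Symbol) (A : RelStr.{u}) (d : A.Dom) (B : RelStr.{v}) (e : B.Dom) : Prop :=
  ∃ Z : A.Dom → B.Dom → Prop, IsBisim S A B Z ∧ Z d e

/-! ### Types -/

/-- `cl(K)`: the concepts in `K` (in its ontology, and the concept names in its database) and
`∃R.⊤`, `∃R⁻.⊤` for the role names `R` in `sig(K)`, closed under subconcepts and single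
negation (the single negation of `¬C` being `C`, and that of any other `C` being `¬C`). -/
inductive KB.Cl (K : KB) : Concept → Prop
  | lhs {I : ConceptInclusion} : I ∈ K.ontology → K.Cl I.lhs
  | rhs {I : ConceptInclusion} : I ∈ K.ontology → K.Cl I.rhs
  | data {A : ConceptName} {a : Const} : GroundAtom.concept A a ∈ K.database → K.Cl (.name A)
  | exTop {R : Role} : R.symbol ∈ K.sig → K.Cl (.ex R .top)
  | subNeg {C : Concept} : K.Cl (.neg C) → K.Cl C
  | subAndLeft {C D : Concept} : K.Cl (.and C D) → K.Cl C
  | subAndRight {C D : Concept} : K.Cl (.and C D) → K.Cl D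
  | subEx {R : Role} {C : Concept} : K.Cl (.ex R C) → K.Cl C
  | neg {C : Concept} : K.Cl C → (∀ D, C ≠ .neg D) → K.Cl (.neg C)

/-- `cl(K)` as a set. -/
def KB.cl (K : KB) : Set Concept := {C | K.Cl C}

/-- `tp_K(A, d)`: the `K`-type of `d` in `A`. -/
def KB.tp (K : KB) (A : RelStr.{u}) (d : A.Dom) : Set Concept :=
  {C | C ∈ K.cl ∧ d ∈ C.ext A}

/-- A type is connected if it contains `∃R.⊤` for some role `R`. -/
def TypeConnected (t : Set Concept) : Prop := ∃ R : Role, Concept.ex R .top ∈ t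

/-- A `K`-type `t` is ALCI-complete if any two pointed models of `K` that realize `t` are
`sig(K)`-bisimilar. -/
def KB.TypeComplete (K : KB) (t : Set Concept) : Prop :=
  ∀ (A₁ A₂ : Struc.{u}) (b₁ : A₁.Dom) (b₂ : A₂.Dom), A₁.IsModel K → A₂.IsModel K →
    t = K.tp A₁.toRelStr b₁ → t = K.tp A₂.toRelStr b₂ →
    Bisimilar K.sig A₁.toRelStr b₁ A₂.toRelStr b₂

/-- `t` is realizable in `K, a`. -/
def KB.Realizable (K : KB) (a : Const) (t : Set Concept) : Prop :=
  ∃ A : Struc.{u}, A.IsModel K ∧ K.tp A.toRelStr (A.const a) = t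

end ALCI

/-! A separating concept fails at `b` in some model `A`. A homomorphism as in condition 1 would
allow the constants around `a` to be reinterpreted so that `a` denotes the same element; a
realization at `a` of a complete type would be bisimilar to it. Both contradict the entailment at
`a`.

Conversely, if the type `t` of `b` in `A` is realizable at no `a`, the negation of the conjunction
describing `t` separates. Condition 2 gives this for connected complete `t`. Condition 1 gives it
for `t` not connected, since a realization would keep `a` out of all role atoms and make a constant
map a homomorphism.

There remains `t` connected but incomplete. By `KB.exists_defect` some type linked to `t` has a
realization that lacks a coherent successor. `Frame.toStruc` unfolds `A` from the constants to a
finite depth and continues each leaf by infinitely many layers. A layer contains every type, with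
all coherent edges within it and to the next layer, and one extra node, which is defective except in
a single window of layers per leaf. Windows start later and get wider as the index of the leaf
grows. Hence concepts of the form "within distance Δ of a point farther than ρ from all defects"
tell apart the nodes of the unfolding with linked types (`Frame.exists_concept_of_ne`).

The separator is the negation of a finite description of `b` in this model. If `a` met the
description in a model of `K`, a bounded simulation would carry the component of `a` into the
unfolding. As nodes are identifiable there, images chosen along different walks coincide, so this is
a homomorphism (`Frame.homTo_of_simTo`); projecting it to `A` contradicts condition 1. -/

namespace ALCI

/-! ### Roles -/

/-- The inverse of a role. -/
def Role.flip : Role → Role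
  | .name R => .inv R
  | .inv R => .name R

@[simp] theorem Role.flip_flip (R : Role) : R.flip.flip = R := by cases R <;> rfl

@[simp] theorem Role.symbol_flip (R : Role) : R.flip.symbol = R.symbol := by cases R <;> rfl

@[simp] theorem RelStr.roleExt_flip (A : RelStr.{u}) (R : Role) (d e : A.Dom) :
    A.roleExt R.flip d e ↔ A.roleExt R e d := by cases R <;> rfl

/-! ### Finiteness of signatures and closures -/

theorem Concept.finite_sig (C : Concept) : C.sig.Finite := by
  induction C with
  | top => exact Set.finite_empty
  | name A => exact Set.finite_singleton _
  | neg C ih => exact ih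
  | and C D ihC ihD => exact ihC.union ihD
  | ex R C ih => exact (Set.finite_singleton _).union ih

theorem KB.finite_sig (K : KB) : K.sig.Finite := by
  have h : K.sig = (⋃ I ∈ K.ontology, (I.lhs.sig ∪ I.rhs.sig)) ∪
      GroundAtom.symbol '' K.database := by
    ext s
    simp only [KB.sig, Set.mem_ofPred_eq, Set.mem_union, Set.mem_iUnion, Set.mem_image,
      Finset.mem_coe, exists_prop, eq_comm]
  rw [h]
  exact (Set.Finite.biUnion K.ontology.finite_toSet
    fun I _ => I.lhs.finite_sig.union I.rhs.finite_sig).union (K.database.finite_toSet.image _)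

theorem finite_roles {S : Set Symbol} (hS : S.Finite) : {R : Role | R.symbol ∈ S}.Finite := by
  have h : (Symbol.role ⁻¹' S).Finite := hS.preimage fun a _ b _ hab => by injection hab
  refine ((h.image Role.name).union (h.image Role.inv)).subset ?_
  rintro (R | R) hR
  · exact Or.inl ⟨R, hR, rfl⟩
  · exact Or.inr ⟨R, hR, rfl⟩

/-- The subconcepts of a concept. -/
def Concept.subs : Concept → Set Concept
  | .top => {.top}
  | .name A => {.name A}
  | .neg C => insert (.neg C) C.subs
  | .and C D => insert (.and C D) (C.subs ∪ D.subs)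
  | .ex R C => insert (.ex R C) C.subs

theorem Concept.finite_subs (C : Concept) : C.subs.Finite := by
  induction C with
  | top => exact Set.finite_singleton _
  | name A => exact Set.finite_singleton _
  | neg C ih => exact ih.insert _
  | and C D ihC ihD => exact (ihC.union ihD).insert _
  | ex R C ih => exact ih.insert _

theorem Concept.self_mem_subs (C : Concept) : C ∈ C.subs := by
  cases C <;> simp [Concept.subs]

theorem Concept.subs_subset {C D : Concept} (h : C ∈ D.subs) : C.subs ⊆ D.subs := by
  induction D with
  | top => cases h; rfl
  | name A => cases h; rfl
  | neg D ih =>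
    rcases h with rfl | h
    · rfl
    · exact (ih h).trans (Set.subset_insert _ _)
  | and D E ihD ihE =>
    rcases h with rfl | h | h
    · rfl
    · exact (ihD h).trans (Set.subset_union_left.trans (Set.subset_insert _ _))
    · exact (ihE h).trans (Set.subset_union_right.trans (Set.subset_insert _ _))
  | ex R D ih =>
    rcases h with rfl | h
    · rfl
    · exact (ih h).trans (Set.subset_insert _ _)

/-- The concepts that generate `cl(K)`. -/
def KB.generators (K : KB) : Set Concept :=
  ((⋃ I ∈ K.ontology, {I.lhs, I.rhs}) ∪
    {C | ∃ A a, GroundAtom.concept A a ∈ K.database ∧ C = .name A}) ∪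
      {C | ∃ R : Role, R.symbol ∈ K.sig ∧ C = .ex R .top}

theorem KB.finite_generators (K : KB) : K.generators.Finite := by
  refine ((Set.Finite.biUnion K.ontology.finite_toSet fun I _ => Set.toFinite _).union ?_).union ?_
  · refine ((K.database.finite_toSet).image
      fun α => match α with
        | .concept A _ => Concept.name A
        | .role _ _ _ => Concept.top).subset ?_
    rintro _ ⟨A, a, h, rfl⟩
    exact ⟨_, h, rfl⟩
  · refine ((finite_roles K.finite_sig).image fun R => Concept.ex R .top).subset ?_
    rintro _ ⟨R, h, rfl⟩
    exact ⟨_, h, rfl⟩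

/-- Single negation never stacks on a negation, so every member is a subconcept of a generator or
the negation of one. -/
theorem KB.finite_cl (K : KB) : K.cl.Finite := by
  set S : Set Concept := ⋃ C ∈ K.generators, C.subs with hS
  have hfin : S.Finite := K.finite_generators.biUnion fun C _ => C.finite_subs
  have gen : ∀ C ∈ K.generators, C ∈ S := fun C hC => by
    simp only [hS, Set.mem_iUnion]
    exact ⟨C, hC, C.self_mem_subs⟩
  have down : ∀ C ∈ S, ∀ D ∈ C.subs, D ∈ S := fun C hC D hD => by
    simp only [hS, Set.mem_iUnion] at hC ⊢
    obtain ⟨E, hE, hCE⟩ := hC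
    exact ⟨E, hE, Concept.subs_subset hCE hD⟩
  refine (hfin.union (hfin.image Concept.neg)).subset ?_
  intro C hC
  induction (hC : K.Cl C) with
  | lhs h =>
    refine Or.inl (gen _ (Or.inl (Or.inl ?_)))
    simp only [Set.mem_iUnion]
    exact ⟨_, h, Or.inl rfl⟩
  | rhs h =>
    refine Or.inl (gen _ (Or.inl (Or.inl ?_)))
    simp only [Set.mem_iUnion]
    exact ⟨_, h, Or.inr rfl⟩
  | data h => exact Or.inl (gen _ (Or.inl (Or.inr ⟨_, _, h, rfl⟩)))
  | exTop h => exact Or.inl (gen _ (Or.inr ⟨_, h, rfl⟩))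
  | @subNeg C h ih =>
    rcases ih with h | ⟨D, h, hD⟩
    · exact Or.inl (down _ h _ (Or.inr C.self_mem_subs))
    · cases hD; exact Or.inl h
  | @subAndLeft C D h ih =>
    rcases ih with h | ⟨D, h, hD⟩
    · exact Or.inl (down _ h _ (Or.inr (Or.inl C.self_mem_subs)))
    · cases hD
  | @subAndRight C D h ih =>
    rcases ih with h | ⟨D, h, hD⟩
    · exact Or.inl (down _ h _ (Or.inr (Or.inr D.self_mem_subs)))
    · cases hD
  | @subEx R C h ih =>
    rcases ih with h | ⟨D, h, hD⟩
    · exact Or.inl (down _ h _ (Or.inr C.self_mem_subs))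
    · cases hD
  | @neg C h hC ih =>
    rcases ih with h | ⟨D, h, rfl⟩
    · exact Or.inr ⟨_, h, rfl⟩
    · exact absurd rfl (hC D)

theorem KB.sig_subset_of_mem_cl {K : KB} {C : Concept} (h : C ∈ K.cl) : C.sig ⊆ K.sig := by
  induction (h : K.Cl C) with
  | lhs h => exact fun s hs => Or.inl ⟨_, h, Or.inl hs⟩
  | rhs h => exact fun s hs => Or.inl ⟨_, h, Or.inr hs⟩
  | data h => rintro _ rfl; exact Or.inr ⟨_, h, rfl⟩
  | exTop h => rintro _ (rfl | ⟨⟨⟩⟩); exact h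
  | subNeg h ih => exact ih
  | subAndLeft h ih => exact Set.subset_union_left.trans ih
  | subAndRight h ih => exact Set.subset_union_right.trans ih
  | subEx h ih => exact Set.subset_union_right.trans ih
  | neg h _ ih => exact ih

theorem KB.role_mem_sig {K : KB} {R : Role} {C : Concept} (h : Concept.ex R C ∈ K.cl) :
    R.symbol ∈ K.sig :=
  KB.sig_subset_of_mem_cl h (Or.inl rfl)

/-- Needed for the atomic clause of the bisimulation in `KB.exists_defect`: names from the ontology
enter the closure as subconcepts. -/
theorem KB.name_mem_cl {K : KB} {N : ConceptName} (h : Symbol.concept N ∈ K.sig) :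
    Concept.name N ∈ K.cl := by
  have key : ∀ C ∈ K.cl, Symbol.concept N ∈ C.sig → Concept.name N ∈ K.cl := by
    intro C
    induction C with
    | top => rintro - ⟨⟩
    | name A => rintro h ⟨⟩; exact h
    | neg C ih => exact fun h => ih (KB.Cl.subNeg h)
    | and C D ihC ihD =>
      rintro h (hs | hs)
      · exact ihC (KB.Cl.subAndLeft h) hs
      · exact ihD (KB.Cl.subAndRight h) hs
    | ex R C ih =>
      rintro h (hs | hs)
      · cases R <;> cases hs
      · exact ih (KB.Cl.subEx h) hs
  rcases h with ⟨I, hI, h | h⟩ | ⟨α, hα, h⟩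
  · exact key _ (KB.Cl.lhs hI) h
  · exact key _ (KB.Cl.rhs hI) h
  · cases α with
    | concept A a => cases h; exact KB.Cl.data hα
    | role R a b => cases h

theorem Database.finite_cons (D : Database) : D.cons.Finite := by
  have h : D.cons = ⋃ α ∈ D, α.cons := by
    ext c; simp [Database.cons]
  rw [h]
  refine Set.Finite.biUnion D.finite_toSet fun α _ => ?_
  cases α with
  | concept A a => exact Set.finite_singleton a
  | role R a b => exact (Set.finite_singleton b).insert a

/-! ### Boolean combinations and neighbourhoods -/

theorem exists_conj {S : Set Symbol} {T : Set Concept} (hT : T.Finite)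
    (hS : ∀ C ∈ T, C.sig ⊆ S) :
    ∃ X : Concept, X.sig ⊆ S ∧ ∀ (A : RelStr.{u}) (d : A.Dom),
      d ∈ X.ext A ↔ ∀ C ∈ T, d ∈ C.ext A := by
  induction T, hT using Set.Finite.induction_on with
  | empty => exact ⟨.top, Set.empty_subset _, fun A d => by simp [Concept.ext]⟩
  | @insert C T _ _ ih =>
    obtain ⟨X, hX, h⟩ := ih fun D hD => hS D (Or.inr hD)
    refine ⟨.and C X, Set.union_subset (hS C (Or.inl rfl)) hX, fun A d => ?_⟩
    simp [Concept.ext, h]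

open Classical in
theorem exists_char {S : Set Symbol} {T : Set Concept} (hT : T.Finite)
    (hS : ∀ C ∈ T, C.sig ⊆ S) (p : Concept → Prop) :
    ∃ X : Concept, X.sig ⊆ S ∧ ∀ (A : RelStr.{u}) (d : A.Dom),
      d ∈ X.ext A ↔ ∀ C ∈ T, (d ∈ C.ext A ↔ p C) := by
  obtain ⟨X, hX, h⟩ := exists_conj.{u} (S := S)
    (hT.image fun C => if p C then C else .neg C) (by
      rintro _ ⟨C, hC, rfl⟩
      dsimp only
      split_ifs
      · exact hS C hC
      · exact hS C hC)
  refine ⟨X, hX, fun A d => (h A d).trans ?_⟩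
  rw [Set.forall_mem_image]
  refine forall₂_congr fun C _ => ?_
  split_ifs with hp <;> simp [hp, Concept.ext]

theorem exists_disj {S : Set Symbol} {T : Set Concept} (hT : T.Finite)
    (hS : ∀ C ∈ T, C.sig ⊆ S) :
    ∃ X : Concept, X.sig ⊆ S ∧ ∀ (A : RelStr.{u}) (d : A.Dom),
      d ∈ X.ext A ↔ ∃ C ∈ T, d ∈ C.ext A := by
  obtain ⟨X, hX, h⟩ := exists_conj.{u} (S := S) (hT.image Concept.neg) (by
    rintro _ ⟨C, hC, rfl⟩; exact hS C hC)
  refine ⟨.neg X, hX, fun A d => ?_⟩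
  simp [Concept.ext, h]

/-- Adjacency of elements by a role over the signature `S`. -/
def RelStr.Adj (A : RelStr.{u}) (S : Set Symbol) (x y : A.Dom) : Prop :=
  ∃ R : Role, R.symbol ∈ S ∧ A.roleExt R x y

theorem RelStr.Adj.symm {A : RelStr.{u}} {S : Set Symbol} {x y : A.Dom} (h : A.Adj S x y) :
    A.Adj S y x := by
  obtain ⟨R, hR, h⟩ := h
  exact ⟨R.flip, by simpa, by simpa⟩

/-- The elements from which `T` can be reached in at most `k` steps. -/
def RelStr.near (A : RelStr.{u}) (S : Set Symbol) (T : Set A.Dom) : ℕ → Set A.Dom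
  | 0 => T
  | k + 1 => {x | x ∈ T ∨ ∃ y, A.Adj S x y ∧ y ∈ A.near S T k}

theorem RelStr.near_succ {A : RelStr.{u}} {S : Set Symbol} {T : Set A.Dom} {x y : A.Dom} {k : ℕ}
    (h : A.Adj S x y) (hy : y ∈ A.near S T k) : x ∈ A.near S T (k + 1) :=
  Or.inr ⟨y, h, hy⟩

theorem RelStr.near_mono {A : RelStr.{u}} {S : Set Symbol} {T : Set A.Dom} {k l : ℕ}
    (h : k ≤ l) : A.near S T k ⊆ A.near S T l := by
  induction l generalizing k with
  | zero => obtain rfl : k = 0 := by omega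
            rfl
  | succ l ih =>
    cases k with
    | zero => exact fun x hx => Or.inl hx
    | succ k =>
      rintro x (hx | ⟨y, hxy, hy⟩)
      · exact Or.inl hx
      · exact Or.inr ⟨y, hxy, ih (by omega) hy⟩

/-- Inverse roles let a concept follow edges in both directions, and finiteness of `S` makes the
disjunction over all roles a concept. -/
theorem exists_near_concept {S : Set Symbol} (hS : S.Finite) {C : Concept} (hC : C.sig ⊆ S)
    (k : ℕ) : ∃ X : Concept, X.sig ⊆ S ∧ ∀ A : RelStr.{u}, X.ext A = A.near S (C.ext A) k := by
  induction k with
  | zero => exact ⟨C, hC, fun A => rfl⟩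
  | succ k ih =>
    obtain ⟨X, hX, h⟩ := ih
    obtain ⟨Y, hY, h'⟩ := exists_disj.{u} (S := S)
      (((finite_roles hS).image fun R => Concept.ex R X).insert C) (by
        rintro _ (rfl | ⟨R, hR, rfl⟩)
        · exact hC
        · exact Set.union_subset (Set.singleton_subset_iff.2 hR) hX)
    refine ⟨Y, hY, fun A => Set.ext fun x => (h' A x).trans ?_⟩
    rw [Set.exists_mem_insert, Set.exists_mem_image]
    simp only [Concept.ext, h A, RelStr.near, RelStr.Adj, Set.mem_ofPred_eq]
    refine or_congr Iff.rfl ⟨?_, ?_⟩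
    · rintro ⟨R, hR, y, hxy, hy⟩
      exact ⟨y, ⟨R, hR, hxy⟩, hy⟩
    · rintro ⟨y, ⟨R, hR, hxy⟩, hy⟩
      exact ⟨R, hR, y, hxy, hy⟩

/-! ### Bisimulations and bounded simulations -/

theorem IsBisim.mem_ext_iff {S : Set Symbol} {A : RelStr.{u}} {B : RelStr.{v}}
    {Z : A.Dom → B.Dom → Prop} (hZ : IsBisim S A B Z) {C : Concept} (hC : C.sig ⊆ S)
    {d : A.Dom} {e : B.Dom} (h : Z d e) : d ∈ C.ext A ↔ e ∈ C.ext B := by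
  induction C generalizing d e with
  | top => exact iff_of_true trivial trivial
  | name N => exact hZ.atom N (hC rfl) d e h
  | neg C ih => exact not_congr (ih hC h)
  | and C D ihC ihD =>
    exact and_congr (ihC (Set.subset_union_left.trans hC) h) (ihD (Set.subset_union_right.trans hC) h)
  | ex R C ih =>
    have hR : R.symbol ∈ S := hC (Or.inl rfl)
    have hC' : C.sig ⊆ S := Set.subset_union_right.trans hC
    constructor
    · rintro ⟨d', hd, hd'⟩
      obtain ⟨e', he, hz⟩ := hZ.forth R hR d e d' h hd
      exact ⟨e', he, (ih hC' hz).1 hd'⟩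
    · rintro ⟨e', he, he'⟩
      obtain ⟨d', hd, hz⟩ := hZ.back R hR d e e' h he
      exact ⟨d', hd, (ih hC' hz).2 he'⟩

/-- Agreement on the concepts in `T`. -/
def Agree (T : Set Concept) (A : RelStr.{u}) (d : A.Dom) (B : RelStr.{v}) (e : B.Dom) : Prop :=
  ∀ C ∈ T, (d ∈ C.ext A ↔ e ∈ C.ext B)

/-- `k`-step simulations by elements that agree on the concepts in `T`. -/
def SimTo (S : Set Symbol) (T : Set Concept) (A : RelStr.{u}) (B : RelStr.{v}) :
    ℕ → A.Dom → B.Dom → Prop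
  | 0, d, e => Agree T A d B e
  | k + 1, d, e => Agree T A d B e ∧ ∀ R : Role, R.symbol ∈ S → ∀ d', A.roleExt R d d' →
      ∃ e', B.roleExt R e e' ∧ SimTo S T A B k d' e'

theorem SimTo.agree {S : Set Symbol} {T : Set Concept} {A : RelStr.{u}} {B : RelStr.{v}} {k : ℕ}
    {d : A.Dom} {e : B.Dom} (h : SimTo S T A B k d e) : Agree T A d B e := by
  cases k with
  | zero => exact h
  | succ k => exact h.1

/-- Bounded simulations relative to finitely many concepts are implied by agreement on finitely
many concepts. -/
theorem exists_finite_agree_simTo {S : Set Symbol} (hS : S.Finite) {T : Set Concept}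
    (hT : T.Finite) (hTS : ∀ C ∈ T, C.sig ⊆ S) (k : ℕ) :
    ∃ U : Set Concept, U.Finite ∧ (∀ C ∈ U, C.sig ⊆ S) ∧
      ∀ (A B : RelStr.{u}) (d : A.Dom) (e : B.Dom), Agree U A d B e → SimTo S T A B k d e := by
  induction k with
  | zero => exact ⟨T, hT, hTS, fun A B d e h => h⟩
  | succ k ih =>
    obtain ⟨U, hU, hUS, h⟩ := ih
    choose X hXS hX using fun V : Set Concept => exists_char.{u} hU hUS (· ∈ V)
    -- `X V` describes the points at which exactly the members `V` of `U` hold; finitely many `V`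
    -- cover all possible successors.
    refine ⟨T ∪ Set.image2 (fun R V => Concept.ex R (X V)) {R : Role | R.symbol ∈ S} (𝒫 U),
      hT.union (Set.Finite.image2 _ (finite_roles hS) hU.finite_subsets), ?_, ?_⟩
    · rintro C (hC | ⟨R, hR, V, -, rfl⟩)
      · exact hTS C hC
      · exact Set.union_subset (Set.singleton_subset_iff.2 hR) (hXS V)
    · intro A B d e hde
      refine ⟨fun C hC => hde C (Or.inl hC), fun R hR d' hd' => ?_⟩
      set V : Set Concept := {C | C ∈ U ∧ d' ∈ C.ext A} with hV
      have hd : d ∈ (Concept.ex R (X V)).ext A :=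
        ⟨d', hd', (hX V A d').2 fun C hC => ⟨fun h => ⟨hC, h⟩, fun h => h.2⟩⟩
      obtain ⟨e', he', hXe⟩ := (hde _ (Or.inr ⟨R, hR, V, fun C hC => hC.1, rfl⟩)).1 hd
      refine ⟨e', he', h A B d' e' fun C hC => ?_⟩
      rw [(hX V B e').1 hXe C hC]
      exact ⟨fun h => ⟨hC, h⟩, fun h => h.2⟩

/-! ### Types -/

theorem KB.mem_tp {K : KB} {A : RelStr.{u}} {d : A.Dom} {C : Concept} (hC : C ∈ K.cl) :
    C ∈ K.tp A d ↔ d ∈ C.ext A :=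
  and_iff_right hC

theorem KB.tp_eq_iff {K : KB} {A : RelStr.{u}} {B : RelStr.{v}} {d : A.Dom} {e : B.Dom} :
    K.tp A d = K.tp B e ↔ Agree K.cl A d B e := by
  constructor
  · intro h C hC
    rw [← KB.mem_tp hC, h, KB.mem_tp hC]
  · intro h
    ext C
    exact and_congr_right (h C)

/-- `t` is the type of some element of some model. -/
def KB.IsType (K : KB) (t : Set Concept) : Prop :=
  ∃ (B : Struc.{u}) (d : B.Dom), B.IsModel K ∧ K.tp B.toRelStr d = t

theorem KB.isType_tp {K : KB} {B : Struc.{u}} (hB : B.IsModel K) (d : B.Dom) :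
    KB.IsType.{u} K (K.tp B.toRelStr d) :=
  ⟨B, d, hB, rfl⟩

namespace KB.IsType

variable {K : KB} {t : Set Concept}

theorem subset_cl (h : KB.IsType.{u} K t) : t ⊆ K.cl := by
  obtain ⟨B, d, -, rfl⟩ := h
  exact fun C hC => hC.1

theorem top_mem (h : KB.IsType.{u} K t) (hcl : Concept.top ∈ K.cl) : Concept.top ∈ t := by
  obtain ⟨B, d, -, rfl⟩ := h
  exact ⟨hcl, trivial⟩

theorem neg_mem (h : KB.IsType.{u} K t) {C : Concept} (hcl : C.neg ∈ K.cl) :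
    C.neg ∈ t ↔ C ∉ t := by
  obtain ⟨B, d, -, rfl⟩ := h
  have hC : C ∈ K.cl := KB.Cl.subNeg hcl
  rw [KB.mem_tp hcl, KB.mem_tp hC]
  rfl

theorem and_mem (h : KB.IsType.{u} K t) {C D : Concept} (hcl : C.and D ∈ K.cl) :
    C.and D ∈ t ↔ C ∈ t ∧ D ∈ t := by
  obtain ⟨B, d, -, rfl⟩ := h
  have hC : C ∈ K.cl := KB.Cl.subAndLeft hcl
  have hD : D ∈ K.cl := KB.Cl.subAndRight hcl
  rw [KB.mem_tp hcl, KB.mem_tp hC, KB.mem_tp hD]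
  rfl

theorem rhs_mem (h : KB.IsType.{u} K t) {I : ConceptInclusion} (hI : I ∈ K.ontology)
    (hl : I.lhs ∈ t) : I.rhs ∈ t := by
  obtain ⟨B, d, hB, rfl⟩ := h
  exact ⟨KB.Cl.rhs hI, hB.1 I hI hl.2⟩

end KB.IsType

theorem KB.finite_isType (K : KB) : {t | KB.IsType.{u} K t}.Finite :=
  K.finite_cl.finite_subsets.subset fun _ ht => ht.subset_cl

/-! ### Coherent types and witnesses of incompleteness -/

/-- `s` and `t` are coherent: an `R`-edge from an element of type `s` to an element of type `t`
is compatible with these types. -/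
def KB.Coh (K : KB) (R : Role) (s t : Set Concept) : Prop :=
  (∀ C, Concept.ex R C ∈ K.cl → C ∈ t → Concept.ex R C ∈ s) ∧
    ∀ C, Concept.ex R.flip C ∈ K.cl → C ∈ s → Concept.ex R.flip C ∈ t

theorem KB.Coh.flip {K : KB} {R : Role} {s t : Set Concept} (h : K.Coh R s t) :
    K.Coh R.flip t s :=
  ⟨h.2, by simpa using h.1⟩

theorem KB.coh_tp (K : KB) {A : RelStr.{u}} {R : Role} {d e : A.Dom} (h : A.roleExt R d e) :
    K.Coh R (K.tp A d) (K.tp A e) :=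
  ⟨fun _ hcl hC => ⟨hcl, e, h, hC.2⟩, fun _ hcl hC => ⟨hcl, d, by simpa using h, hC.2⟩⟩

theorem KB.Coh.typeConnected {K : KB} {R : Role} {s t : Set Concept} (h : K.Coh R s t)
    (hR : R.symbol ∈ K.sig) (hs : KB.IsType.{u} K s) : TypeConnected t := by
  have hcl : Concept.ex R.flip .top ∈ K.cl := KB.Cl.exTop (by simpa)
  exact ⟨R.flip, h.2 _ hcl (hs.top_mem (KB.Cl.subEx hcl))⟩

/-- Adjacency in the graph of coherent types. -/
def KB.CohAdj (K : KB) (s t : Set Concept) : Prop :=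
  KB.IsType.{u} K s ∧ KB.IsType.{u} K t ∧ ∃ R : Role, R.symbol ∈ K.sig ∧ K.Coh R s t

theorem KB.CohAdj.symm {K : KB} {s t : Set Concept} (h : KB.CohAdj.{u} K s t) :
    KB.CohAdj.{u} K t s := by
  obtain ⟨hs, ht, R, hR, h⟩ := h
  exact ⟨ht, hs, R.flip, by simpa, h.flip⟩

/-- Connectedness in the graph of coherent types. -/
abbrev KB.Linked (K : KB) : Set Concept → Set Concept → Prop :=
  Relation.ReflTransGen (KB.CohAdj.{u} K)

theorem KB.Linked.symm {K : KB} {s t : Set Concept} (h : KB.Linked.{u} K s t) :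
    KB.Linked.{u} K t s := by
  induction h with
  | refl => exact .refl
  | tail _ h ih => exact .head h.symm ih

theorem KB.Linked.typeConnected {K : KB} {s t : Set Concept} (h : KB.Linked.{u} K s t)
    (hs : TypeConnected s) : TypeConnected t := by
  cases h with
  | refl => exact hs
  | tail _ h =>
    obtain ⟨hs, ht, R, hR, h⟩ := h
    exact h.typeConnected hR hs

theorem KB.Linked.isType {K : KB} {s t : Set Concept} (h : KB.Linked.{u} K s t)
    (hs : KB.IsType.{u} K s) : KB.IsType.{u} K t := by
  cases h with
  | refl => exact hs
  | tail _ h => exact h.2.1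

/-- The types with a path of length `k` to `r` in the graph of coherent types. -/
def KB.pathTo (K : KB) (r : Set Concept) : ℕ → Set (Set Concept)
  | 0 => {r}
  | k + 1 => {s | ∃ t, KB.CohAdj.{u} K s t ∧ t ∈ KB.pathTo K r k}

/-- One bound serves all types because there are only finitely many. -/
theorem KB.exists_pathTo_bound (K : KB) (r : Set Concept) :
    ∃ l, ∀ s, KB.IsType.{u} K s → KB.Linked.{u} K s r → ∃ k ≤ l, s ∈ KB.pathTo.{u} K r k := by
  have h1 : ∀ s, ∃ k, KB.Linked.{u} K s r → s ∈ KB.pathTo.{u} K r k := by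
    intro s
    by_cases h : KB.Linked.{u} K s r
    · induction h using Relation.ReflTransGen.head_induction_on with
      | refl => exact ⟨0, fun _ => rfl⟩
      | head h hr ih =>
        obtain ⟨k, hk⟩ := ih
        exact ⟨k + 1, fun _ => ⟨_, h, hk hr⟩⟩
    · exact ⟨0, fun h' => absurd h' h⟩
  choose k hk using h1
  obtain ⟨l, hl⟩ := ((K.finite_isType).image k).bddAbove
  exact ⟨l, fun s hs hsr => ⟨k s, hl ⟨s, hs, rfl⟩, hk s hsr⟩⟩

/-- A witness of incompleteness: the type `ty`, together with the set `succ` of pairs of a role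
and a type that are realized at the successors of some element of type `ty`, which lacks the
coherent `role`-successor of type `missing`. -/
structure Defect (K : KB) where
  ty : Set Concept
  isType : KB.IsType.{u} K ty
  succ : Role → Set Concept → Prop
  succ_isType : ∀ R t, succ R t → KB.IsType.{u} K t
  succ_coh : ∀ R t, succ R t → K.Coh R ty t
  succ_demand : ∀ R C, Concept.ex R C ∈ ty → ∃ t, succ R t ∧ C ∈ t
  role : Role
  role_mem : role.symbol ∈ K.sig
  missing : Set Concept
  missing_isType : KB.IsType.{u} K missing
  missing_coh : K.Coh role ty missing
  not_succ : ¬ succ role missing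

/-- If no realization of a type linked to `t` lacked a coherent successor, equality of types,
restricted to those linked to `t`, would be a bisimulation. -/
theorem KB.exists_defect {K : KB} {t : Set Concept}
    (h : ¬ KB.TypeComplete.{u} K t) : ∃ δ : Defect.{u} K, KB.Linked.{u} K t δ.ty := by
  by_contra hno
  push Not at hno
  have full : ∀ (M : Struc.{u}), M.IsModel K → ∀ x : M.Dom, KB.Linked.{u} K t (K.tp M.toRelStr x) →
      ∀ R : Role, R.symbol ∈ K.sig → ∀ s, KB.IsType.{u} K s → K.Coh R (K.tp M.toRelStr x) s →
        ∃ y, M.roleExt R x y ∧ K.tp M.toRelStr y = s := by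
    intro M hM x hx R hR s hs hcoh
    by_contra hy
    refine hno
      { ty := K.tp M.toRelStr x
        isType := KB.isType_tp hM x
        succ := fun S v => ∃ y, M.roleExt S x y ∧ K.tp M.toRelStr y = v
        succ_isType := ?_
        succ_coh := ?_
        succ_demand := ?_
        role := R
        role_mem := hR
        missing := s
        missing_isType := hs
        missing_coh := hcoh
        not_succ := hy } hx
    · rintro _ _ ⟨y, -, rfl⟩
      exact KB.isType_tp hM y
    · rintro S _ ⟨y, hy, rfl⟩
      exact K.coh_tp hy
    · rintro S C ⟨hcl, y, hy, hC⟩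
      exact ⟨_, ⟨y, hy, rfl⟩, KB.Cl.subEx hcl, hC⟩
  apply h
  intro A₁ A₂ b₁ b₂ h₁ h₂ e₁ e₂
  have step : ∀ (M N : Struc.{u}), M.IsModel K → N.IsModel K → ∀ (R : Role), R.symbol ∈ K.sig →
      ∀ (d : M.Dom) (e : N.Dom) (d' : M.Dom), KB.Linked.{u} K t (K.tp M.toRelStr d) →
      K.tp M.toRelStr d = K.tp N.toRelStr e → M.roleExt R d d' →
      ∃ e', N.roleExt R e e' ∧ KB.Linked.{u} K t (K.tp M.toRelStr d') ∧
        K.tp M.toRelStr d' = K.tp N.toRelStr e' := by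
    intro M N hM hN R hR d e d' hl heq hd
    have hcoh := K.coh_tp hd
    obtain ⟨e', he', htp⟩ := full N hN e (heq ▸ hl) R hR _ (KB.isType_tp hM d') (heq ▸ hcoh)
    exact ⟨e', he', hl.tail ⟨KB.isType_tp hM d, KB.isType_tp hM d', R, hR, hcoh⟩, htp.symm⟩
  refine ⟨fun x y => KB.Linked.{u} K t (K.tp A₁.toRelStr x) ∧
    K.tp A₁.toRelStr x = K.tp A₂.toRelStr y, ⟨?_, ?_, ?_⟩, ?_⟩
  · rintro N hN d e ⟨-, h⟩
    exact KB.tp_eq_iff.1 h _ (KB.name_mem_cl hN)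
  · rintro R hR d e d' ⟨hl, h⟩ hd
    exact step A₁ A₂ h₁ h₂ R hR d e d' hl h hd
  · rintro R hR d e e' ⟨hl, h⟩ he
    obtain ⟨d', hd', hl', h'⟩ := step A₂ A₁ h₂ h₁ R hR e d e' (h ▸ hl) h.symm he
    exact ⟨d', hd', h' ▸ hl', h'.symm⟩
  · exact ⟨e₁ ▸ .refl, e₁.symm.trans e₂⟩

/-! ### Connected components of databases -/

theorem Database.reachable_of_mem {D : Database} {α : GroundAtom} (hα : α ∈ D) {c d : Const}
    (hc : c ∈ α.cons) (hd : d ∈ α.cons) : D.gaifman.Reachable c d := by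
  by_cases h : c = d
  · rw [h]
  · exact SimpleGraph.Adj.reachable (G := D.gaifman) ⟨h, α, hα, hc, hd⟩

theorem Database.mem_con {D : Database} {a : Const} {α : GroundAtom} :
    α ∈ D.con a ↔ α ∈ D ∧ ∀ c ∈ α.cons, D.gaifman.Reachable a c := by
  classical
  simp [Database.con]

theorem Database.mem_con_of_reachable {D : Database} {a c : Const} {α : GroundAtom} (hα : α ∈ D)
    (hc : c ∈ α.cons) (h : D.gaifman.Reachable a c) : α ∈ D.con a :=
  Database.mem_con.2 ⟨hα, fun _ hd => h.trans (Database.reachable_of_mem hα hc hd)⟩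

theorem Database.reachable_of_mem_cons_con {D : Database} {a c : Const}
    (h : c ∈ Database.cons (D.con a)) : D.gaifman.Reachable a c := by
  obtain ⟨α, hα, hc⟩ := h
  exact (Database.mem_con.1 hα).2 c hc

theorem Database.mem_cons_con_self {D : Database} {a : Const} (h : a ∈ D.cons) :
    a ∈ Database.cons (D.con a) := by
  obtain ⟨α, hα, ha⟩ := h
  exact ⟨α, Database.mem_con_of_reachable hα ha .rfl, ha⟩

/-! ### Necessity of the two conditions -/

open Classical in
/-- Reinterpreting the constants of a connected component along a homomorphism. -/
theorem exists_isModel_of_homTo {K : KB} {A : Struc.{u}} (hA : A.IsModel K) {a : Const}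
    {d : A.Dom} (h : (K.database.con a).HomTo a A.toRelStr d) :
    ∃ f : Const → A.Dom, f a = d ∧ (Struc.mk A.toRelStr f).IsModel K := by
  obtain ⟨ha, h, hh, rfl⟩ := h
  set f : Const → A.Dom :=
    fun c => if hc : c ∈ Database.cons (K.database.con a) then h ⟨c, hc⟩ else A.const c with hf
  have pos : ∀ c (hc : c ∈ Database.cons (K.database.con a)), f c = h ⟨c, hc⟩ :=
    fun c hc => dif_pos hc
  have neg : ∀ c, c ∉ Database.cons (K.database.con a) → f c = A.const c := fun c hc => dif_neg hc
  refine ⟨f, pos a ha, hA.1, fun α hα => ?_⟩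
  by_cases hcon : α ∈ K.database.con a
  · have hc : ∀ c ∈ α.cons, c ∈ Database.cons (K.database.con a) := fun c hc => ⟨α, hcon, hc⟩
    cases α with
    | concept N c =>
      change f c ∈ A.conc N
      rw [pos c (hc c rfl)]
      exact hh.conc N _ hcon
    | role R c c' =>
      change A.role R (f c) (f c')
      rw [pos c (hc c (Or.inl rfl)), pos c' (hc c' (Or.inr rfl))]
      exact hh.role R _ _ hcon
  -- No atom straddles the component: one constant in it would put the whole atom inside. So `f` is
  -- the old interpretation on `α`.
  · have hc : ∀ c ∈ α.cons, c ∉ Database.cons (K.database.con a) := fun c hc hcc =>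
      hcon (Database.mem_con_of_reachable hα hc (Database.reachable_of_mem_cons_con hcc))
    have := hA.2 α hα
    cases α with
    | concept N c =>
      change f c ∈ A.conc N
      rwa [neg c (hc c rfl)]
    | role R c c' =>
      change A.role R (f c) (f c')
      rwa [neg c (hc c (Or.inl rfl)), neg c' (hc c' (Or.inr rfl))]

theorem not_homTo_of_entails {K : KB} {A : Struc.{u}} (hA : A.IsModel K) {C : Concept}
    {a : Const} (ha : KB.Entails.{u} K C a) {d : A.Dom} (hd : d ∉ C.ext A.toRelStr) :
    ¬ (K.database.con a).HomTo a A.toRelStr d := by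
  intro h
  obtain ⟨f, rfl, hf⟩ := exists_isModel_of_homTo hA h
  exact hd (ha _ hf)

theorem not_realizable_of_entails {K : KB} {A : Struc.{u}} (hA : A.IsModel K) {C : Concept}
    (hC : C.sig ⊆ K.sig) {a : Const} (ha : KB.Entails.{u} K C a) {d : A.Dom}
    (hd : d ∉ C.ext A.toRelStr) (hcomp : KB.TypeComplete.{u} K (K.tp A.toRelStr d)) :
    ¬ KB.Realizable.{u} K a (K.tp A.toRelStr d) := by
  rintro ⟨B, hB, htp⟩
  obtain ⟨Z, hZ, hz⟩ := hcomp A B d (B.const a) hA hB rfl htp.symm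
  exact hd ((hZ.mem_ext_iff hC hz).2 (ha B hB))

/-! ### Sufficiency for types that are not connected or complete -/

theorem homTo_of_not_typeConnected {K : KB} {B : Struc.{u}} (hB : B.IsModel K) {a : Const}
    (ha : a ∈ K.database.cons) {A : RelStr.{v}} {d : A.Dom}
    (h : K.tp B.toRelStr (B.const a) = K.tp A d) (hd : ¬ TypeConnected (K.tp A d)) :
    (K.database.con a).HomTo a A d := by
  have norole : ∀ R c c', GroundAtom.role R c c' ∈ K.database → a ≠ c ∧ a ≠ c' := by
    intro R c c' hR
    have hsig : Symbol.role R ∈ K.sig := Or.inr ⟨_, hR, rfl⟩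
    have hrole : B.role R (B.const c) (B.const c') := hB.2 _ hR
    constructor
    · rintro rfl
      refine hd ⟨.name R, ?_⟩
      rw [← h]
      exact ⟨KB.Cl.exTop hsig, _, hrole, trivial⟩
    · rintro rfl
      refine hd ⟨.inv R, ?_⟩
      rw [← h]
      exact ⟨KB.Cl.exTop hsig, _, hrole, trivial⟩
  refine ⟨Database.mem_cons_con_self ha, fun _ => d, ⟨?_, ?_⟩, rfl⟩
  · rintro N ⟨c, hc⟩ hN
    -- The first edge of a nontrivial walk would come from a role atom containing `a`.
    obtain ⟨w⟩ := Database.reachable_of_mem_cons_con hc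
    have hac : a = c := by
      cases w with
      | nil => rfl
      | cons hadj _ =>
        obtain ⟨hne, α, hα, h1, h2⟩ := hadj
        cases α with
        | concept N c => exact absurd (h1.trans h2.symm) hne
        | role R c c' =>
          rcases h1 with h1 | h1
          · exact absurd h1 (norole R c c' hα).1
          · exact absurd h1 (norole R c c' hα).2
    subst hac
    have hN' : GroundAtom.concept N a ∈ K.database := (Database.mem_con.1 hN).1
    exact (KB.tp_eq_iff.1 h _ (KB.Cl.data hN')).1 (hB.2 _ hN')
  · rintro R ⟨c, hc⟩ ⟨c', hc'⟩ hR
    have hR' := Database.mem_con.1 hR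
    obtain ⟨w⟩ := Database.reachable_of_mem_cons_con hc
    cases w with
    | nil => exact absurd rfl (norole R a c' hR'.1).1
    | cons hadj _ =>
      obtain ⟨hne, α, hα, h1, h2⟩ := hadj
      cases α with
      | concept N c => exact absurd (h1.trans h2.symm) hne
      | role R c c' =>
        rcases h1 with h1 | h1
        · exact absurd h1 (norole R c c' hα).1
        · exact absurd h1 (norole R c c' hα).2

theorem separable_of_type_not_realizable (L : LabeledKB) {A : Struc.{u}} (hA : A.IsModel L.kb)
    {b : Const} (hb : L.neg = {b})
    (h : ∀ a ∈ L.pos, ¬ KB.Realizable.{u} L.kb a (L.kb.tp A.toRelStr (A.const b))) :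
    LabeledKB.NonProjectivelySeparable.{u} L := by
  obtain ⟨X, hXS, hX⟩ := exists_char.{u} L.kb.finite_cl
    (fun C hC => KB.sig_subset_of_mem_cl hC) (fun C => A.const b ∈ C.ext A.toRelStr)
  refine ⟨.neg X, hXS, fun a ha B hB hBX => ?_, fun b' hb' hent => ?_⟩
  · exact h a ha ⟨B, hB, KB.tp_eq_iff.2 ((hX _ _).1 hBX)⟩
  · rw [hb] at hb'
    obtain rfl : b' = b := hb'
    exact hent A hA ((hX _ _).2 fun _ _ => Iff.rfl)

/-! ### The unfolded model -/

open Classical in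
/-- A witness for an existential restriction at an element. -/
noncomputable def RelStr.witness (A : RelStr.{u}) (C : Concept) (d : A.Dom) : A.Dom :=
  match C with
  | .ex R D => if h : ∃ e, A.roleExt R d e ∧ e ∈ D.ext A then h.choose else d
  | _ => d

theorem RelStr.witness_spec {A : RelStr.{u}} {R : Role} {D : Concept} {d : A.Dom}
    (h : d ∈ (Concept.ex R D).ext A) :
    A.roleExt R d (A.witness (.ex R D) d) ∧ A.witness (.ex R D) d ∈ D.ext A := by
  have h' : ∃ e, A.roleExt R d e ∧ e ∈ D.ext A := h
  simp only [RelStr.witness, dif_pos h']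
  exact h'.choose_spec

/-- The parameters of the construction: a model, the depth up to which it is unfolded, an
enumeration of the leaves of the unfolding, a witness of incompleteness and, for each leaf, the
distance and the radius of a region without defects. -/
structure Frame (K : KB) where
  base : Struc.{u}
  isModel : base.IsModel K
  depth : ℕ
  idx : Const × List K.cl → ℕ
  idx_injective : Function.Injective idx
  defect : Defect.{u} K
  start : ℕ → ℕ
  radius : ℕ → ℕ

/-- The nodes of the constructed model: those of the unfolding, and those of the layered graphs of
types attached to its leaves, each layer having one additional node that can be defective. -/
inductive Node (K : KB) : Type u
  | tree (c : Const) (w : List K.cl)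
  | level (i n : ℕ) (t : {t : Set Concept // KB.IsType.{u} K t})
  | extra (i n : ℕ)

/-- The graph and the layer of a node outside the unfolding. -/
def Node.pos {K : KB} : Node.{u} K → Option (ℕ × ℕ)
  | .tree _ _ => none
  | .level i n _ => some (i, n)
  | .extra i n => some (i, n)

namespace Frame

variable {K : KB} (F : Frame.{u} K)

/-- The layers with a defect. -/
def Dense (i n : ℕ) : Prop := n < F.start i ∨ F.start i + 2 * F.radius i < n

/-- The element of the base model that a node of the unfolding represents. -/
noncomputable def val (c : Const) : List K.cl → F.base.Dom
  | [] => F.base.const c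
  | C :: w => F.base.witness C.1 (val c w)

/-- The intended types of the nodes. -/
noncomputable def label : Node.{u} K → Set Concept
  | .tree c w => K.tp F.base.toRelStr (F.val c w)
  | .level _ _ t => t.1
  | .extra _ _ => F.defect.ty

/-- The edges of the constructed model, each in one of its two directions. -/
inductive Edge : Role → Node.{u} K → Node.{u} K → Prop
  | child {c : Const} {w : List K.cl} {C : K.cl} {R : Role} {D : Concept} : C.1 = .ex R D →
      C.1 ∈ F.label (.tree c w) → w.length < F.depth → Edge R (.tree c w) (.tree c (C :: w))
  | data {R : RoleName} {c c' : Const} : GroundAtom.role R c c' ∈ K.database →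
      Edge (.name R) (.tree c []) (.tree c' [])
  | leaf {c : Const} {w : List K.cl} {R : Role} {t : {t : Set Concept // KB.IsType.{u} K t}} :
      R.symbol ∈ K.sig → K.Coh R (F.label (.tree c w)) t.1 → F.depth ≤ w.length →
      Edge R (.tree c w) (.level (F.idx (c, w)) 0 t)
  | level {i n n' : ℕ} {R : Role} {t t' : {t : Set Concept // KB.IsType.{u} K t}} :
      R.symbol ∈ K.sig → K.Coh R t.1 t'.1 → n' ≤ n + 1 → n ≤ n' + 1 →
      Edge R (.level i n t) (.level i n' t')
  | extra {i n : ℕ} {R : Role} {t : {t : Set Concept // KB.IsType.{u} K t}} :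
      R.symbol ∈ K.sig → K.Coh R F.defect.ty t.1 → (F.Dense i n → F.defect.succ R t.1) →
      Edge R (.extra i n) (.level i n t)

/-- The constructed model. -/
noncomputable def toStruc : Struc.{u} where
  Dom := Node.{u} K
  conc N := {x | Concept.name N ∈ F.label x}
  role R x y := F.Edge (.name R) x y ∨ F.Edge (.inv R) y x
  const c := .tree c []

/-- The constructed model without its constants. -/
noncomputable abbrev str : RelStr.{u} := F.toStruc.toRelStr

theorem roleExt_iff {R : Role} {x y : Node.{u} K} :
    F.str.roleExt R x y ↔ F.Edge R x y ∨ F.Edge R.flip y x := by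
  cases R with
  | name R => rfl
  | inv R => exact or_comm

variable {F}

theorem Edge.roleExt {R : Role} {x y : Node.{u} K} (h : F.Edge R x y) : F.str.roleExt R x y :=
  F.roleExt_iff.2 (.inl h)

theorem Edge.base {R : Role} {c c' : Const} {w w' : List K.cl}
    (h : F.Edge R (.tree c w) (.tree c' w')) : F.base.roleExt R (F.val c w) (F.val c' w') := by
  cases h with
  | @child _ _ C R D hC hm hw =>
    have := (RelStr.witness_spec (A := F.base.toRelStr) (hC ▸ hm.2)).1
    rw [← hC] at this
    exact this
  | data h => exact F.isModel.2 _ h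

theorem Edge.mem_sig {R : Role} {x y : Node.{u} K} (h : F.Edge R x y) : R.symbol ∈ K.sig := by
  cases h with
  | child hC hm hw => exact KB.role_mem_sig (hC ▸ hm.1)
  | data h => exact Or.inr ⟨_, h, rfl⟩
  | leaf h _ _ => exact h
  | level h _ _ _ => exact h
  | extra h _ _ => exact h

theorem Edge.coh {R : Role} {x y : Node.{u} K} (h : F.Edge R x y) :
    K.Coh R (F.label x) (F.label y) := by
  have h' := h
  cases h with
  | child hC hm hw => exact K.coh_tp h'.base
  | data h => exact K.coh_tp h'.base
  | leaf _ h _ => exact h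
  | level _ h _ _ => exact h
  | extra _ h _ => exact h

variable (F)

theorem roleExt_base {R : Role} {c c' : Const} {w w' : List K.cl}
    (h : F.str.roleExt R (.tree c w) (.tree c' w')) :
    F.base.roleExt R (F.val c w) (F.val c' w') := by
  rcases F.roleExt_iff.1 h with h | h
  · exact h.base
  · simpa using h.base

theorem roleExt_coh {R : Role} {x y : Node.{u} K} (h : F.str.roleExt R x y) :
    K.Coh R (F.label x) (F.label y) := by
  rcases F.roleExt_iff.1 h with h | h
  · exact h.coh
  · simpa using h.coh.flip

theorem label_isType (x : Node.{u} K) : KB.IsType.{u} K (F.label x) := by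
  cases x with
  | tree c w => exact KB.isType_tp F.isModel _
  | level i n t => exact t.2
  | extra i n => exact F.defect.isType

/-- Inner nodes of the unfolding use the chosen witness, leaves and layer nodes the type of a
successor in a model realizing their type, extra nodes the successors recorded in the defect. -/
theorem exists_succ {R : Role} {C : Concept} {x : Node.{u} K} (h : Concept.ex R C ∈ F.label x) :
    ∃ y, F.str.roleExt R x y ∧ C ∈ F.label y := by
  have hcl : Concept.ex R C ∈ K.cl := (F.label_isType x).subset_cl h
  have hR := KB.role_mem_sig hcl
  have hC : C ∈ K.cl := KB.Cl.subEx hcl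
  cases x with
  | tree c w =>
    by_cases hw : w.length < F.depth
    · exact ⟨.tree c (⟨_, hcl⟩ :: w), (Edge.child (C := ⟨_, hcl⟩) rfl h hw).roleExt, hC,
        (RelStr.witness_spec h.2).2⟩
    · obtain ⟨-, e, he, hCe⟩ := h
      exact ⟨.level _ 0 ⟨K.tp F.base.toRelStr e, KB.isType_tp F.isModel e⟩,
        (Edge.leaf (F := F) (c := c) (w := w) (t := ⟨_, KB.isType_tp F.isModel e⟩) hR (K.coh_tp he)
          (not_lt.1 hw)).roleExt, hC, hCe⟩
  | level i n t =>
    obtain ⟨_, B, d, hB, rfl⟩ := t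
    obtain ⟨-, e, he, hCe⟩ := h
    exact ⟨.level i n ⟨K.tp B.toRelStr e, KB.isType_tp hB e⟩,
      (Edge.level hR (K.coh_tp he) (by omega) (by omega)).roleExt, hC, hCe⟩
  | extra i n =>
    obtain ⟨t, ht, hCt⟩ := F.defect.succ_demand R C h
    exact ⟨.level i n ⟨t, F.defect.succ_isType R t ht⟩,
      (Edge.extra hR (F.defect.succ_coh R t ht) fun _ => ht).roleExt, hCt⟩

/-- For existential restrictions, coherence of the edges gives one direction and `exists_succ` the
other. -/
theorem mem_ext_iff {C : Concept} (hC : C ∈ K.cl) (x : Node.{u} K) :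
    x ∈ C.ext F.str ↔ C ∈ F.label x := by
  induction C generalizing x with
  | top => exact iff_of_true trivial ((F.label_isType x).top_mem hC)
  | name N => rfl
  | neg C ih =>
    rw [(F.label_isType x).neg_mem hC]
    exact not_congr (ih (KB.Cl.subNeg hC) x)
  | and C D ihC ihD =>
    rw [(F.label_isType x).and_mem hC]
    exact and_congr (ihC (KB.Cl.subAndLeft hC) x) (ihD (KB.Cl.subAndRight hC) x)
  | ex R C ih =>
    have hC' : C ∈ K.cl := KB.Cl.subEx hC
    constructor
    · rintro ⟨y, hxy, hy⟩
      exact (F.roleExt_coh hxy).1 C hC ((ih hC' y).1 hy)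
    · intro h
      obtain ⟨y, hxy, hy⟩ := F.exists_succ h
      exact ⟨y, hxy, (ih hC' y).2 hy⟩

theorem tp_eq_label (x : Node.{u} K) : K.tp F.str x = F.label x := by
  ext C
  exact ⟨fun h => (F.mem_ext_iff h.1 x).1 h.2, fun h =>
    ⟨(F.label_isType x).subset_cl h, (F.mem_ext_iff ((F.label_isType x).subset_cl h) x).2 h⟩⟩

theorem toStruc_isModel : F.toStruc.IsModel K := by
  refine ⟨fun I hI x hx => ?_, fun α hα => ?_⟩
  · refine (F.mem_ext_iff (KB.Cl.rhs hI) x).2 ?_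
    exact (F.label_isType x).rhs_mem hI ((F.mem_ext_iff (KB.Cl.lhs hI) x).1 hx)
  · cases α with
    | concept N c => exact ⟨KB.Cl.data hα, F.isModel.2 _ hα⟩
    | role R c c' => exact Or.inl (Edge.data hα)

/-! ### Neighbours of nodes -/

/-- Adjacency in the constructed model. -/
abbrev Adj : Node.{u} K → Node.{u} K → Prop := F.str.Adj K.sig

theorem Adj.cohAdj {F : Frame.{u} K} {x y : Node.{u} K} (h : F.Adj x y) :
    KB.CohAdj.{u} K (F.label x) (F.label y) := by
  obtain ⟨R, hR, h⟩ := h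
  exact ⟨F.label_isType x, F.label_isType y, R, hR, F.roleExt_coh h⟩

variable {F}

theorem Edge.adj {R : Role} {x y : Node.{u} K} (h : F.Edge R x y) : F.Adj x y :=
  ⟨R, h.mem_sig, h.roleExt⟩

theorem Adj.exists_edge {x y : Node.{u} K} (h : F.Adj x y) :
    ∃ R, F.Edge R x y ∨ F.Edge R y x := by
  obtain ⟨R, -, h⟩ := h
  rcases F.roleExt_iff.1 h with h | h
  · exact ⟨R, .inl h⟩
  · exact ⟨R.flip, .inr h⟩

theorem Adj.of_pos {x y : Node.{u} K} (h : F.Adj x y) {i n : ℕ} (hx : x.pos = some (i, n)) :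
    (∃ n', y.pos = some (i, n') ∧ n' ≤ n + 1 ∧ n ≤ n' + 1) ∨
      (n = 0 ∧ ∃ c w, y = .tree c w ∧ F.idx (c, w) = i) := by
  obtain ⟨R, h | h⟩ := h.exists_edge
  · cases h with
    | child | data | leaf => cases hx
    | level _ _ h1 h2 => cases hx; exact .inl ⟨_, rfl, h1, h2⟩
    | extra => cases hx; exact .inl ⟨_, rfl, by omega, by omega⟩
  · cases h with
    | child | data => cases hx
    | leaf => cases hx; exact .inr ⟨rfl, _, _, rfl, rfl⟩
    | level _ _ h1 h2 => cases hx; exact .inl ⟨_, rfl, h2, h1⟩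
    | extra => cases hx; exact .inl ⟨_, rfl, by omega, by omega⟩

theorem Adj.of_tree {c : Const} {w : List K.cl} {y : Node.{u} K} (h : F.Adj (.tree c w) y) :
    (y.pos = some (F.idx (c, w), 0) ∧ F.depth ≤ w.length) ∨
      (∃ C, y = .tree c (C :: w)) ∨ (∃ C w', w = C :: w' ∧ y = .tree c w') ∨
        (w = [] ∧ ∃ c' ∈ K.database.cons, y = .tree c' []) := by
  obtain ⟨R, h | h⟩ := h.exists_edge
  · cases h with
    | child => exact .inr (.inl ⟨_, rfl⟩)
    | data he => exact .inr (.inr (.inr ⟨rfl, _, ⟨_, he, Or.inr rfl⟩, rfl⟩))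
    | leaf _ _ he => exact .inl ⟨rfl, he⟩
  · cases h with
    | child => exact .inr (.inr (.inl ⟨_, _, rfl, rfl⟩))
    | data he => exact .inr (.inr (.inr ⟨rfl, _, ⟨_, he, Or.inl rfl⟩, rfl⟩))

/-- The part of the constructed model below a node of the unfolding. -/
def below (F : Frame.{u} K) (c : Const) (w : List K.cl) : Set (Node.{u} K) :=
  {x | (∃ w', x = .tree c w' ∧ w <:+ w') ∨
    ∃ w' n, x.pos = some (F.idx (c, w'), n) ∧ w <:+ w'}

theorem tree_mem_below {c c' : Const} {w w' : List K.cl} :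
    Node.tree c' w' ∈ F.below c w ↔ c' = c ∧ w <:+ w' := by
  constructor
  · rintro (⟨w', h, hw⟩ | ⟨w', n, h, hw⟩)
    · cases h; exact ⟨rfl, hw⟩
    · cases h
  · rintro ⟨rfl, h⟩
    exact .inl ⟨_, rfl, h⟩

theorem pos_mem_below {c : Const} {w w' : List K.cl} {x : Node.{u} K} {n : ℕ}
    (hx : x.pos = some (F.idx (c, w'), n)) (hw : w <:+ w') : x ∈ F.below c w :=
  .inr ⟨w', n, hx, hw⟩

/-- Layers return to the unfolding only at their own leaf, which `idx_injective` identifies, so the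
part below a node can be left only from that node. -/
theorem Adj.eq_of_mem_below {c : Const} {w : List K.cl} {x y : Node.{u} K} (h : F.Adj y x)
    (hy : y ∈ F.below c w) (hx : x ∉ F.below c w) : y = .tree c w := by
  rcases hy with ⟨w', rfl, hw⟩ | ⟨w', n, hpos, hw⟩
  · rcases h.of_tree with ⟨h, -⟩ | ⟨C, rfl⟩ | ⟨C, w'', rfl, rfl⟩ | ⟨rfl, -⟩
    · exact absurd (pos_mem_below h hw) hx
    · exact absurd (tree_mem_below.2 ⟨rfl, hw.trans (List.suffix_cons C w')⟩) hx
    · rcases List.suffix_cons_iff.1 hw with rfl | hw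
      · rfl
      · exact absurd (tree_mem_below.2 ⟨rfl, hw⟩) hx
    · rw [List.suffix_nil.1 hw]
  · rcases h.of_pos hpos with ⟨n', h, -⟩ | ⟨-, c', w'', rfl, hidx⟩
    · exact absurd (pos_mem_below h hw) hx
    · cases F.idx_injective hidx
      exact absurd (tree_mem_below.2 ⟨rfl, hw⟩) hx

end Frame

namespace Frame

variable {K : KB} (F : Frame.{u} K)

/-! ### Distances to defects -/

/-- The elements from which `T` can be reached in at most `k` steps. -/
abbrev near (T : Set (Node.{u} K)) (k : ℕ) : Set (Node.{u} K) := F.str.near K.sig T k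

/-- The elements that have the type of the defect and lack the missing successor. -/
def defects : Set (Node.{u} K) :=
  {x | F.label x = F.defect.ty ∧
    ∀ y, F.str.roleExt F.defect.role x y → F.label y ≠ F.defect.missing}

/-- The nodes whose types are linked to that of the defect. -/
def Good (x : Node.{u} K) : Prop := KB.Linked.{u} K F.defect.ty (F.label x)

variable {F}

theorem Good.adj {x y : Node.{u} K} (hx : F.Good x) (h : F.Adj x y) : F.Good y :=
  hx.tail h.cohAdj

theorem Edge.succ_of_extra {R : Role} {i n : ℕ} {y : Node.{u} K} (h : F.Edge R (.extra i n) y)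
    (hd : F.Dense i n) : F.defect.succ R (F.label y) := by
  cases h with
  | extra _ _ hs => exact hs hd

theorem not_edge_extra {R : Role} {i n : ℕ} {y : Node.{u} K} : ¬ F.Edge R y (.extra i n) := by
  rintro ⟨⟩

theorem extra_mem_defects {i n : ℕ} (h : F.Dense i n) : Node.extra i n ∈ F.defects := by
  refine ⟨rfl, fun y hy hlab => ?_⟩
  rcases F.roleExt_iff.1 hy with he | he
  · exact F.defect.not_succ (hlab ▸ he.succ_of_extra h)
  · exact not_edge_extra he

/-- A layer node is joined to all coherent types in its own layer, the missing one included. -/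
theorem level_notMem_defects {i n : ℕ} {t : {t : Set Concept // KB.IsType.{u} K t}} :
    Node.level i n t ∉ F.defects := by
  rintro ⟨h, hno⟩
  refine hno (.level i n ⟨_, F.defect.missing_isType⟩)
    (Edge.level F.defect.role_mem ?_ (by omega) (by omega)).roleExt rfl
  have h' : t.1 = F.defect.ty := h
  rw [h']
  exact F.defect.missing_coh

theorem extra_notMem_defects {i n : ℕ} (h : ¬ F.Dense i n) : Node.extra i n ∉ F.defects := by
  rintro ⟨-, hno⟩
  exact hno (.level i n ⟨_, F.defect.missing_isType⟩)
    (Edge.extra F.defect.role_mem F.defect.missing_coh fun h' => absurd h' h).roleExt rfl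

theorem notMem_defects_of_pos {x : Node.{u} K} {i n : ℕ} (hx : x.pos = some (i, n))
    (h : ¬ F.Dense i n) : x ∉ F.defects := by
  cases x with
  | tree => cases hx
  | level => exact level_notMem_defects
  | extra => cases hx; exact extra_notMem_defects h

/-- An edge changes the layer by at most one. While steps are left the layer is positive, so the
path cannot escape into the unfolding. -/
theorem notMem_near_defects {i n j : ℕ} {x : Node.{u} K} (hx : x.pos = some (i, n))
    (h1 : F.start i + j ≤ n) (h2 : n + j ≤ F.start i + 2 * F.radius i) :
    x ∉ F.near F.defects j := by
  have hd : ∀ m, F.start i ≤ m → m ≤ F.start i + 2 * F.radius i → ¬ F.Dense i m := by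
    rintro m h1 h2 (h | h) <;> omega
  induction j generalizing x n with
  | zero => exact notMem_defects_of_pos hx (hd n (by omega) (by omega))
  | succ j ih =>
    rintro (h | ⟨y, hxy, hy⟩)
    · exact notMem_defects_of_pos hx (hd n (by omega) (by omega)) h
    · rcases Adj.of_pos hxy hx with ⟨n', hy', h3, h4⟩ | ⟨h, -⟩
      · exact ih hy' (by omega) (by omega) hy
      · omega

/-- The type of the defect has a neighbour of type `r`, at most `l` steps away from all types
linked to it. -/
structure _root_.ALCI.Defect.Bound (δ : Defect.{u} K) (R : Role) (r : Set Concept) (l : ℕ) :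
    Prop where
  mem_sig : R.symbol ∈ K.sig
  succ : δ.succ R r
  path : ∀ s, KB.IsType.{u} K s → KB.Linked.{u} K s r → ∃ k ≤ l, s ∈ KB.pathTo.{u} K r k

theorem _root_.ALCI.Defect.exists_bound (δ : Defect.{u} K) (h : TypeConnected δ.ty) :
    ∃ R r l, δ.Bound R r l := by
  obtain ⟨R, hR⟩ := h
  obtain ⟨r, hr, -⟩ := δ.succ_demand R .top hR
  obtain ⟨l, hl⟩ := KB.exists_pathTo_bound.{u} K r
  exact ⟨R, r, l, KB.role_mem_sig (δ.isType.subset_cl hR), hr, hl⟩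

/-! ### Upper bounds on the distance to defects -/

section

variable {R : Role} {r : Set Concept} {l : ℕ} (hb : F.defect.Bound R r l)
include hb

theorem linked_succ : KB.Linked.{u} K F.defect.ty r :=
  .single ⟨F.defect.isType, F.defect.succ_isType _ _ hb.succ, R, hb.mem_sig,
    F.defect.succ_coh _ _ hb.succ⟩

theorem exists_cohAdj {s : Set Concept} (h : KB.Linked.{u} K F.defect.ty s) :
    ∃ s', KB.CohAdj.{u} K s s' := by
  cases h with
  | refl => exact ⟨r, F.defect.isType, F.defect.succ_isType _ _ hb.succ, R, hb.mem_sig,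
      F.defect.succ_coh _ _ hb.succ⟩
  | tail _ h => exact ⟨_, h.symm⟩

theorem typeConnected_of_good {x : Node.{u} K} (h : F.Good x) :
    ∃ R : Role, Concept.ex R .top ∈ F.label x := by
  obtain ⟨s', h1, h2, R', hR', h'⟩ := exists_cohAdj hb h
  have := KB.CohAdj.symm (K := K) ⟨h1, h2, R', hR', h'⟩
  obtain ⟨-, -, S, hS, hc⟩ := this
  exact hc.typeConnected hS h2

/-- A path of types leads within the layer to the node of type `r`, which is adjacent to the
defective extra node. -/
theorem level_mem_near_of_dense {i n : ℕ} {t : {t : Set Concept // KB.IsType.{u} K t}}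
    (ht : F.Good (.level i n t)) (hd : F.Dense i n) :
    Node.level i n t ∈ F.near F.defects (l + 1) := by
  obtain ⟨k, hk, hp⟩ := hb.path t.1 t.2 (.trans (KB.Linked.symm ht) (linked_succ hb))
  refine RelStr.near_mono (show k + 1 ≤ l + 1 by omega) ?_
  clear hk ht
  induction k generalizing t with
  | zero =>
    have ht : t.1 = r := hp
    exact RelStr.near_succ (Edge.adj (Edge.extra hb.mem_sig
      (ht ▸ F.defect.succ_coh _ _ hb.succ) fun _ => ht ▸ hb.succ)).symm (extra_mem_defects hd)
  | succ k ih =>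
    obtain ⟨t', ⟨-, ht', S, hS, hc⟩, hp'⟩ := hp
    exact RelStr.near_succ (Edge.adj (Edge.level (t' := ⟨t', ht'⟩) hS hc (by omega) (by omega)))
      (ih hp')

/-- A good node of a layered graph has good neighbours in all layers that are close enough. -/
theorem exists_adj_level {i n : ℕ} {t : {t : Set Concept // KB.IsType.{u} K t}}
    (ht : F.Good (.level i n t)) (n' : ℕ) (h1 : n' ≤ n + 1) (h2 : n ≤ n' + 1) :
    ∃ t', F.Adj (.level i n t) (.level i n' t') := by
  obtain ⟨t', h, ht', S, hS, hc⟩ := exists_cohAdj hb ht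
  exact ⟨⟨t', ht'⟩, Edge.adj (Edge.level hS hc h1 h2)⟩

theorem level_mem_near_of_dense_below {i n j : ℕ} {t : {t : Set Concept // KB.IsType.{u} K t}}
    (ht : F.Good (.level i (n + j) t)) (hd : F.Dense i n) :
    Node.level i (n + j) t ∈ F.near F.defects (l + 1 + j) := by
  induction j generalizing t with
  | zero => exact level_mem_near_of_dense hb ht hd
  | succ j ih =>
    obtain ⟨t', h⟩ := exists_adj_level hb ht (n + j) (by omega) (by omega)
    exact RelStr.near_succ h (ih (ht.adj h))

/-- Inside the window one descends to the dense layer just before it. This takes at most as many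
steps as the window has layers, so either bound in `hm` suffices. -/
theorem level_mem_near {i n : ℕ} {t : {t : Set Concept // KB.IsType.{u} K t}}
    (ht : F.Good (.level i n t)) (hs : 0 < F.start i) {m : ℕ}
    (hm : n + 1 - F.start i ≤ m ∨ 2 * F.radius i + 1 ≤ m) :
    Node.level i n t ∈ F.near F.defects (l + 1 + m) := by
  by_cases hd : F.Dense i n
  · exact RelStr.near_mono (by omega) (level_mem_near_of_dense hb ht hd)
  · have hd' : F.start i ≤ n ∧ n ≤ F.start i + 2 * F.radius i := by
      unfold Dense at hd; omega
    obtain ⟨j, rfl⟩ : ∃ j, n = (F.start i - 1) + j := ⟨n + 1 - F.start i, by omega⟩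
    exact RelStr.near_mono (by omega)
      (level_mem_near_of_dense_below hb ht (Or.inl (by omega)))

theorem mem_near_of_pos {x : Node.{u} K} {i n : ℕ} (hx : x.pos = some (i, n))
    (hgood : F.Good x) (hs : 0 < F.start i) {m : ℕ}
    (hm : n + 1 - F.start i ≤ m ∨ 2 * F.radius i + 1 ≤ m) :
    x ∈ F.near F.defects (l + 2 + m) := by
  cases x with
  | tree => cases hx
  | level =>
    cases hx
    exact RelStr.near_mono (by omega) (level_mem_near hb hgood hs hm)
  | extra =>
    cases hx
    have hadj : F.Adj (.extra i n) (.level i n ⟨r, F.defect.succ_isType _ _ hb.succ⟩) :=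
      Edge.adj (Edge.extra hb.mem_sig (F.defect.succ_coh _ _ hb.succ) fun _ => hb.succ)
    exact RelStr.near_mono (by omega)
      (RelStr.near_succ hadj (level_mem_near hb (hgood.adj hadj) hs hm))

theorem exists_adj_leaf {c : Const} {w : List K.cl} (hgood : F.Good (.tree c w))
    (hw : F.depth ≤ w.length) : ∃ t, F.Adj (.tree c w) (.level (F.idx (c, w)) 0 t) := by
  obtain ⟨t', h, ht', S, hS, hc⟩ := exists_cohAdj hb hgood
  exact ⟨⟨t', ht'⟩, Edge.adj (Edge.leaf hS hc hw)⟩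

theorem exists_adj_child {c : Const} {w : List K.cl} (hgood : F.Good (.tree c w))
    (hw : w.length < F.depth) : ∃ C, F.Adj (.tree c w) (.tree c (C :: w)) := by
  obtain ⟨S, hS⟩ := typeConnected_of_good hb hgood
  exact ⟨⟨_, (F.label_isType _).subset_cl hS⟩, Edge.adj (Edge.child rfl hS hw)⟩

/-- Below every good node of the unfolding there is a leaf. -/
theorem exists_leaf_below {c : Const} {w : List K.cl} (hgood : F.Good (.tree c w)) {j : ℕ}
    (hj : F.depth ≤ w.length + j) :
    ∃ w', w <:+ w' ∧ ∀ (T : Set (Node.{u} K)) (m : ℕ),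
      (∀ t, F.Good (.level (F.idx (c, w')) 0 t) → Node.level (F.idx (c, w')) 0 t ∈ F.near T m) →
      Node.tree c w ∈ F.near T (m + 1 + j) := by
  induction j generalizing w with
  | zero =>
    obtain ⟨t, ht⟩ := exists_adj_leaf hb hgood hj
    exact ⟨w, List.suffix_rfl, fun T m h => RelStr.near_succ ht (h t (hgood.adj ht))⟩
  | succ j ih =>
    by_cases hw : w.length < F.depth
    · obtain ⟨C, hC⟩ := exists_adj_child hb hgood hw
      obtain ⟨w', hw', h⟩ := ih (hgood.adj hC) (by simp only [List.length_cons]; omega)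
      exact ⟨w', (List.suffix_cons C w).trans hw', fun T m hT => RelStr.near_succ hC (h T m hT)⟩
    · obtain ⟨w', hw', h⟩ := ih hgood (by omega)
      exact ⟨w', hw', fun T m hT => RelStr.near_mono (by omega) (h T m hT)⟩

theorem tree_mem_near (hs : ∀ i, 0 < F.start i) {c : Const} {w : List K.cl}
    (hgood : F.Good (.tree c w)) : Node.tree c w ∈ F.near F.defects (l + 2 + F.depth) := by
  obtain ⟨w', -, h⟩ := exists_leaf_below hb hgood (j := F.depth) (by omega)
  -- Layer `0` is dense because every window starts later.
  exact h _ (l + 1) fun t ht => level_mem_near_of_dense hb ht (Or.inl (hs _))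

/-- The middle of the region without defects is reached from the first layer. -/
theorem level_mem_near_of_layer {i n j : ℕ} {T : Set (Node.{u} K)}
    (hT : ∀ t, Node.level i (n + j) t ∈ T) {t : {t : Set Concept // KB.IsType.{u} K t}}
    (ht : F.Good (.level i n t)) : Node.level i n t ∈ F.near T j := by
  induction j generalizing n t with
  | zero => exact hT t
  | succ j ih =>
    obtain ⟨t', h⟩ := exists_adj_level hb ht (n + 1) (by omega) (by omega)
    exact RelStr.near_succ h (ih (fun t => by rw [Nat.add_right_comm]; exact hT t) (ht.adj h))

end

/-! ### Separating the nodes of the unfolding -/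

theorem exists_defects_concept (F : Frame.{u} K) :
    ∃ X : Concept, X.sig ⊆ K.sig ∧ X.ext F.str = F.defects := by
  have hchar : ∀ s, KB.IsType.{u} K s →
      ∃ X : Concept, X.sig ⊆ K.sig ∧ ∀ x, x ∈ X.ext F.str ↔ F.label x = s := by
    rintro s ⟨B, d, hB, rfl⟩
    obtain ⟨X, hXS, hX⟩ := exists_char.{u} K.finite_cl
      (fun C hC => KB.sig_subset_of_mem_cl hC) (fun C => d ∈ C.ext B.toRelStr)
    refine ⟨X, hXS, fun x => ?_⟩
    exact (hX F.str x).trans ⟨fun h => (F.tp_eq_label x).symm.trans (KB.tp_eq_iff.2 h),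
      fun h => KB.tp_eq_iff.1 ((F.tp_eq_label x).trans h)⟩
  obtain ⟨X, hXS, hX⟩ := hchar _ F.defect.isType
  obtain ⟨Y, hYS, hY⟩ := hchar _ F.defect.missing_isType
  refine ⟨.and X (.neg (.ex F.defect.role Y)), Set.union_subset hXS (Set.union_subset
    (Set.singleton_subset_iff.2 F.defect.role_mem) hYS), Set.ext fun x => ?_⟩
  refine and_congr (hX x) ?_
  constructor
  · exact fun h y hxy hy => h ⟨y, hxy, (hY y).2 hy⟩
  · rintro h ⟨y, hxy, hy⟩
    exact h y hxy ((hY y).1 hy)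

/-- The conditions on the regions without defects that make them recognizable. -/
structure Spread (F : Frame.{u} K) (l : ℕ) : Prop where
  start_pos : ∀ i, 0 < F.start i
  start_add_le : ∀ i j, i < j → F.start i + F.depth + l + 5 ≤ F.start j
  le_radius : ∀ i, F.depth + l + 3 ≤ F.radius i
  radius_lt : ∀ i j, i < j → 2 * F.radius i + l + 3 < F.radius j

section

variable {R : Role} {r : Set Concept} {l : ℕ} (hb : F.defect.Bound R r l) (hF : F.Spread l)
include hb hF

/-- Nodes far from all defects are found only far inside of graphs with a large index. -/
theorem pos_of_notMem_near {i : ℕ} {x : Node.{u} K} (hgood : F.Good x)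
    (hx : x ∉ F.near F.defects (F.radius i)) :
    ∃ j n, x.pos = some (j, n) ∧ i ≤ j ∧ F.radius i + F.start j < n + l + 3 := by
  have key : ∀ j n, x.pos = some (j, n) → i ≤ j ∧ F.radius i + F.start j < n + l + 3 := by
    intro j n hpos
    have hle := hF.le_radius i
    constructor
    · by_contra hji
      have := hF.radius_lt j i (by omega)
      exact hx (RelStr.near_mono (show l + 2 + (2 * F.radius j + 1) ≤ F.radius i by omega)
        (mem_near_of_pos hb hpos hgood (hF.start_pos j) (Or.inr le_rfl)))
    · by_contra hn
      exact hx (RelStr.near_mono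
        (show l + 2 + (n + 1 - F.start j) ≤ F.radius i by omega)
        (mem_near_of_pos hb hpos hgood (hF.start_pos j) (Or.inl le_rfl)))
  cases x with
  | tree c w =>
    have hle := hF.le_radius i
    exact absurd (RelStr.near_mono (show l + 2 + F.depth ≤ F.radius i by omega)
      (tree_mem_near hb hF.start_pos hgood)) hx
  | level j n t => exact ⟨j, n, rfl, key j n rfl⟩
  | extra j n => exact ⟨j, n, rfl, key j n rfl⟩

/-- From `(c, w)` one can descend to a leaf `v` and on to the middle of its window, farther than
`radius i` from all defects. Good points that far from defects and not below `(c, w)` lie in graphs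
of larger index, whose windows start too late to be reached as quickly. -/
theorem exists_concept_of_notMem_below {c c' : Const} {w w' : List K.cl}
    (hgood : F.Good (.tree c w)) (hgood' : F.Good (.tree c' w'))
    (hnot : Node.tree c' w' ∉ F.below c w) :
    ∃ X : Concept, X.sig ⊆ K.sig ∧ Node.tree c w ∈ X.ext F.str ∧
      Node.tree c' w' ∉ X.ext F.str := by
  classical
  obtain ⟨v, hv, hreach⟩ := exists_leaf_below hb hgood (j := F.depth) (by omega)
  set i := F.idx (c, v) with hi
  set T : Set (Node.{u} K) := (F.near F.defects (F.radius i))ᶜ with hT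
  have hmem : Node.tree c w ∈ F.near T (F.start i + F.radius i + 1 + F.depth) := by
    refine hreach T _ fun t ht => level_mem_near_of_layer hb (fun t => ?_) ht
    exact notMem_near_defects (i := i) rfl (by omega) (by omega)
  have hex : ∃ k, Node.tree c w ∈ F.near T k := ⟨_, hmem⟩
  -- `Δ` is the exact distance from `(c, w)` to `T`.
  set Δ := Nat.find hex with hΔ
  have hΔ1 : Node.tree c w ∈ F.near T Δ := Nat.find_spec hex
  have hΔ2 : ∀ k, Node.tree c w ∈ F.near T k → Δ ≤ k := fun k hk => Nat.find_min' hex hk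
  have hΔ3 : Δ ≤ F.start i + F.radius i + 1 + F.depth := hΔ2 _ hmem
  -- A path to `T` from outside either passes through `(c, w)`, costing more than `Δ`, or ends deep
  -- in another graph. A step changes the layer by at most one, so layer plus remaining distance is
  -- at least the final depth.
  have main : ∀ k x, F.Good x → x ∉ F.below c w → x ∈ F.near T k →
      Δ + 1 ≤ k ∨ ∃ j n, x.pos = some (j, n) ∧ Δ + 1 ≤ n + k := by
    have base : ∀ x, F.Good x → x ∉ F.below c w → x ∈ T →
        ∃ j n, x.pos = some (j, n) ∧ Δ + 1 ≤ n := by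
      intro x hx hxb hxT
      obtain ⟨j, n, hpos, hij, hn⟩ := pos_of_notMem_near hb hF hx hxT
      have hne : i ≠ j := by
        rintro rfl
        exact hxb (pos_mem_below hpos hv)
      have := hF.start_add_le i j (by omega)
      exact ⟨j, n, hpos, by omega⟩
    intro k
    induction k with
    | zero =>
      intro x hx hxb hxT
      exact .inr (base x hx hxb hxT)
    | succ k ih =>
      rintro x hx hxb (hxT | ⟨y, hxy, hy⟩)
      · obtain ⟨j, n, hpos, hn⟩ := base x hx hxb hxT
        exact .inr ⟨j, n, hpos, by omega⟩
      · by_cases hyb : y ∈ F.below c w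
        · obtain rfl := Adj.eq_of_mem_below (RelStr.Adj.symm hxy) hyb hxb
          have := hΔ2 k hy
          exact .inl (by omega)
        · rcases ih y (hx.adj hxy) hyb hy with h | ⟨j, n, hpos, hn⟩
          · exact .inl (by omega)
          -- A graph is left only from layer `0`, where the invariant already bounds the distance
          -- alone.
          · rcases Adj.of_pos (RelStr.Adj.symm hxy) hpos with ⟨n', hpos', h1, h2⟩ | ⟨rfl, -⟩
            · exact .inr ⟨j, n', hpos', by omega⟩
            · exact .inl (by omega)
  have hnot' : Node.tree c' w' ∉ F.near T Δ := by
    intro h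
    rcases main Δ _ hgood' hnot h with h | ⟨j, n, h, -⟩
    · omega
    · cases h
  obtain ⟨D, hDS, hD⟩ := F.exists_defects_concept
  obtain ⟨Y, hYS, hY⟩ := exists_near_concept.{u} K.finite_sig hDS (F.radius i)
  obtain ⟨X, hXS, hX⟩ := exists_near_concept.{u} (C := .neg Y) K.finite_sig hYS Δ
  have hext : X.ext F.str = F.near T Δ := by
    rw [hX, Concept.ext, hY, hD]
    rfl
  exact ⟨X, hXS, hext ▸ hΔ1, hext ▸ hnot'⟩

/-- Distinct nodes cannot each lie below the other, so the preceding lemma applies in one direction.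
-/
theorem exists_concept_of_ne {c c' : Const} {w w' : List K.cl}
    (hgood : F.Good (.tree c w)) (hgood' : F.Good (.tree c' w')) (hne : (c, w) ≠ (c', w')) :
    ∃ X : Concept, X.sig ⊆ K.sig ∧ ¬ (Node.tree c w ∈ X.ext F.str ↔
      Node.tree c' w' ∈ X.ext F.str) := by
  by_cases h : Node.tree c' w' ∈ F.below c w
  · obtain ⟨rfl, hw⟩ := tree_mem_below.1 h
    have h' : Node.tree c' w ∉ F.below c' w' := by
      intro h'
      have hw' := (tree_mem_below.1 h').2
      exact hne (by rw [hw.eq_of_length_le hw'.length_le])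
    obtain ⟨X, hXS, h1, h2⟩ := exists_concept_of_notMem_below hb hF hgood' hgood h'
    exact ⟨X, hXS, fun h => h2 (h.2 h1)⟩
  · obtain ⟨X, hXS, h1, h2⟩ := exists_concept_of_notMem_below hb hF hgood hgood' h
    exact ⟨X, hXS, fun h => h2 (h.1 h1)⟩

end

end Frame

namespace Frame

variable {K : KB} {F : Frame.{u} K}

/-! ### Homomorphisms from simulations -/

/-- The length bound excludes leaves, so the simulating successor stays in the unfolding. -/
theorem exists_simTo_succ {T : Set Concept} {B : RelStr.{u}} {k : ℕ} {d d' : B.Dom} {R : Role}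
    {c : Const} {w : List K.cl} (h : SimTo K.sig T B F.str (k + 1) d (Node.tree c w))
    (hgood : F.Good (.tree c w)) (hc : c ∈ K.database.cons) (hw : w.length < F.depth)
    (hR : R.symbol ∈ K.sig) (hd : B.roleExt R d d') :
    ∃ c' w', c' ∈ K.database.cons ∧ w'.length ≤ w.length + 1 ∧ F.Good (.tree c' w') ∧
      F.str.roleExt R (Node.tree c w) (Node.tree c' w') ∧
      SimTo K.sig T B F.str k d' (Node.tree c' w') := by
  obtain ⟨y, hxy, hy⟩ := h.2 R hR d' hd
  have hadj : F.Adj (.tree c w) y := ⟨R, hR, hxy⟩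
  have hgy := hgood.adj hadj
  rcases hadj.of_tree with ⟨-, h⟩ | ⟨C, rfl⟩ | ⟨C, w', rfl, rfl⟩ | ⟨rfl, c', hc', rfl⟩
  · omega
  · exact ⟨c, C :: w, hc, by simp, hgy, hxy, hy⟩
  · exact ⟨c, w', hc, by simp only [List.length_cons]; omega, hgy, hxy, hy⟩
  · exact ⟨c', [], hc', by simp, hgy, hxy, hy⟩

/-- The walk is traversed from its end `a`; each edge uses up one simulation step and lengthens the
word by at most one. -/
theorem exists_simTo_of_walk {T : Set Concept} {B : Struc.{u}} (hB : B.IsModel K) {b : Const}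
    (hb : b ∈ K.database.cons) (hgood : F.Good (.tree b [])) {c a : Const}
    (p : K.database.gaifman.Walk c a) {k : ℕ} (hp : p.length < F.depth)
    (h : SimTo K.sig T B.toRelStr F.str (p.length + k) (B.const a) (Node.tree b [])) :
    ∃ c' w', c' ∈ K.database.cons ∧ w'.length ≤ p.length ∧ F.Good (.tree c' w') ∧
      SimTo K.sig T B.toRelStr F.str k (B.const c) (Node.tree c' w') := by
  induction p generalizing k with
  | nil => exact ⟨b, [], hb, le_rfl, hgood, by simpa using h⟩
  | @cons c v a hadj p ih =>
    rw [SimpleGraph.Walk.length_cons] at hp h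
    obtain ⟨c₁, w₁, hc₁, hw₁, hg₁, hs₁⟩ := ih (k := k + 1) (by omega)
      (by rwa [show p.length + (k + 1) = p.length + 1 + k by omega])
    obtain ⟨R, hR, hRB⟩ : ∃ R : Role, R.symbol ∈ K.sig ∧
        B.roleExt R (B.const v) (B.const c) := by
      obtain ⟨hne, α, hα, h1, h2⟩ := hadj
      cases α with
      | concept N e => exact absurd (h1.trans h2.symm) hne
      | role S e e' =>
        have hS : Symbol.role S ∈ K.sig := Or.inr ⟨_, hα, rfl⟩
        have hSB : B.role S (B.const e) (B.const e') := hB.2 _ hα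
        rcases h1 with rfl | h1 <;> rcases h2 with rfl | h2
        · exact absurd rfl hne
        · cases h2
          exact ⟨.inv S, hS, hSB⟩
        · cases h1
          exact ⟨.name S, hS, hSB⟩
        · cases h1
          exact absurd h2.symm hne
    obtain ⟨c₂, w₂, hc₂, hw₂, hg₂, -, hs₂⟩ :=
      exists_simTo_succ hs₁ hg₁ hc₁ (by omega) hR hRB
    exact ⟨c₂, w₂, hc₂, by rw [SimpleGraph.Walk.length_cons]; omega, hg₂, hs₂⟩

theorem homTo_of_simTo {T : Set Concept} (hcl : K.cl ⊆ T)
    (hT : ∀ c w c' w', c ∈ K.database.cons → c' ∈ K.database.cons → w.length < F.depth →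
      w'.length < F.depth → F.Good (.tree c w) → F.Good (.tree c' w') →
      Agree T F.str (Node.tree c w) F.str (Node.tree c' w') → (c, w) = (c', w'))
    {B : Struc.{u}} (hB : B.IsModel K) {a b : Const} (ha : a ∈ K.database.cons)
    (hb : b ∈ K.database.cons) (hgood : F.Good (.tree b [])) {m : ℕ} (hm : m + 1 < F.depth)
    (hdist : ∀ c ∈ K.database.cons, K.database.gaifman.dist c a ≤ m)
    (h : SimTo K.sig T B.toRelStr F.str (m + 1) (B.const a) (Node.tree b [])) :
    (K.database.con a).HomTo a F.base.toRelStr (F.base.const b) := by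
  have agree : ∀ {d : B.Dom} {c w c' w'}, Agree T B.toRelStr d F.str (Node.tree c w) →
      Agree T B.toRelStr d F.str (Node.tree c' w') →
      Agree T F.str (Node.tree c w) F.str (Node.tree c' w') :=
    fun h h' C hC => (h C hC).symm.trans (h' C hC)
  have key : ∀ c : Database.cons (K.database.con a), ∃ x : Const × List K.cl,
      x.1 ∈ K.database.cons ∧ x.2.length ≤ m ∧ F.Good (.tree x.1 x.2) ∧
      ∃ k, SimTo K.sig T B.toRelStr F.str (k + 1) (B.const c.1) (Node.tree x.1 x.2) := by
    rintro ⟨c, hc⟩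
    have hcD : c ∈ K.database.cons := by
      obtain ⟨α, hα, hcα⟩ := hc
      exact ⟨α, (Database.mem_con.1 hα).1, hcα⟩
    obtain ⟨p, hp⟩ := (Database.reachable_of_mem_cons_con hc).symm.exists_walk_length_eq_dist
    have hpm : p.length ≤ m := hp ▸ hdist c hcD
    -- One simulation step is kept in reserve for checking role atoms.
    obtain ⟨c', w', hc', hw', hg, hs⟩ := exists_simTo_of_walk (T := T) hB hb hgood p
      (k := m - p.length + 1) (by omega)
      (by rwa [show p.length + (m - p.length + 1) = m + 1 by omega])
    exact ⟨(c', w'), hc', hw'.trans hpm, hg, _, hs⟩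
  choose f hfc hfw hfg hfs using key
  have haa : a ∈ Database.cons (K.database.con a) := Database.mem_cons_con_self ha
  refine ⟨haa, fun c => F.val (f c).1 (f c).2, ⟨?_, ?_⟩, ?_⟩
  · intro N c hN
    have hN' : GroundAtom.concept N c.1 ∈ K.database := (Database.mem_con.1 hN).1
    obtain ⟨k, hk⟩ := hfs c
    have h1 : Node.tree (f c).1 (f c).2 ∈ (Concept.name N).ext F.str :=
      (hk.agree _ (hcl (KB.Cl.data hN'))).1 (hB.2 _ hN')
    exact ((F.mem_ext_iff (KB.Cl.data hN') _).1 h1).2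
  · intro R c c' hR
    have hR' : GroundAtom.role R c.1 c'.1 ∈ K.database := (Database.mem_con.1 hR).1
    obtain ⟨k, hk⟩ := hfs c
    obtain ⟨k', hk'⟩ := hfs c'
    have hw := hfw c
    have hw' := hfw c'
    obtain ⟨c₁, w₁, hc₁, hw₁, hg₁, he₁, hs₁⟩ := exists_simTo_succ (R := .name R) hk (hfg c) (hfc c)
      (by omega) (Or.inr ⟨_, hR', rfl⟩) (hB.2 _ hR')
    -- The successor just found and the node assigned to `c'` both agree on `T` with `c'` in `B`,
    -- hence are the same node.
    cases hT _ _ _ _ hc₁ (hfc c') (by omega) (by omega) hg₁ (hfg c') (agree hs₁.agree hk'.agree)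
    exact F.roleExt_base he₁
  · obtain ⟨k, hk⟩ := hfs ⟨a, haa⟩
    have hw := hfw ⟨a, haa⟩
    have h0 := hT b [] _ _ hb (hfc ⟨a, haa⟩) (by simp only [List.length_nil]; omega)
      (by omega) hgood (hfg ⟨a, haa⟩) (agree h.agree hk.agree)
    change F.val (f ⟨a, haa⟩).1 (f ⟨a, haa⟩).2 = F.val b []
    rw [Prod.mk.injEq] at h0
    rw [← h0.1, ← h0.2]

end Frame

/-! ### Sufficiency for connected incomplete types -/

theorem separable_of_not_typeComplete (L : LabeledKB) {A : Struc.{u}} (hA : A.IsModel L.kb)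
    {b : Const} (hb : L.neg = {b})
    (hhom : ∀ a ∈ L.pos, ¬ (L.kb.database.con a).HomTo a A.toRelStr (A.const b))
    (hconn : TypeConnected (L.kb.tp A.toRelStr (A.const b)))
    (hcomp : ¬ KB.TypeComplete.{u} L.kb (L.kb.tp A.toRelStr (A.const b))) :
    LabeledKB.NonProjectivelySeparable.{u} L := by
  obtain ⟨δ, hδ⟩ := KB.exists_defect hcomp
  obtain ⟨R, r, l, hbound⟩ := δ.exists_bound (hδ.typeConnected hconn)
  have hbD : b ∈ L.kb.database.cons := L.neg_subset (hb ▸ rfl)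
  have hfin := L.kb.database.finite_cons
  obtain ⟨m, hm⟩ := ((hfin.prod hfin).image fun x => L.kb.database.gaifman.dist x.1 x.2).bddAbove
  have hdist : ∀ a ∈ L.kb.database.cons, ∀ c ∈ L.kb.database.cons,
      L.kb.database.gaifman.dist c a ≤ m := fun a ha c hc => hm ⟨(c, a), ⟨hc, ha⟩, rfl⟩
  have : Finite L.kb.cl := L.kb.finite_cl
  obtain ⟨idx, hidx⟩ := Countable.exists_injective_nat (Const × List L.kb.cl)
  -- `M` dominates the additive constants in `Spread`. Starts are spaced by `M`; tripling the radii
  -- leaves each one above twice any earlier one with enough room.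
  set M := m + l + 10 with hM
  let F : Frame.{u} L.kb :=
    { base := A
      isModel := hA
      -- Constants are mapped to words of length at most `m`, and successors of these have length at
      -- most `m + 1`; all must lie strictly above the leaves.
      depth := m + 2
      idx := idx
      idx_injective := hidx
      defect := δ
      start := fun i => i * M + 1
      radius := fun i => 3 ^ i * M }
  have hF : F.Spread l := by
    refine ⟨fun i => Nat.succ_pos _, fun i j hij => ?_, fun i => ?_, fun i j hij => ?_⟩
    · have : (i + 1) * M ≤ j * M := Nat.mul_le_mul_right M hij
      change i * M + 1 + (m + 2) + l + 5 ≤ j * M + 1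
      rw [Nat.add_mul] at this
      omega
    · have : 1 * M ≤ 3 ^ i * M := Nat.mul_le_mul_right M (Nat.one_le_pow _ _ (by norm_num))
      change m + 2 + l + 3 ≤ 3 ^ i * M
      omega
    · have h1 : 3 ^ (i + 1) * M ≤ 3 ^ j * M :=
        Nat.mul_le_mul_right M (Nat.pow_le_pow_right (by norm_num) hij)
      have h2 : 1 * M ≤ 3 ^ i * M := Nat.mul_le_mul_right M (Nat.one_le_pow _ _ (by norm_num))
      have h3 : 3 ^ (i + 1) * M = 3 * (3 ^ i * M) := by ring
      change 2 * (3 ^ i * M) + l + 3 < 3 ^ j * M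
      omega
  have hgood : F.Good (.tree b []) := KB.Linked.symm hδ
  set X : Set (Const × List L.kb.cl) :=
    {x | (x.1 ∈ L.kb.database.cons ∧ x.2.length < m + 2) ∧ F.Good (.tree x.1 x.2)} with hX
  have hXfin : X.Finite := by
    refine (hfin.prod (List.finite_length_lt L.kb.cl (m + 2))).subset ?_
    rintro x ⟨hx, -⟩
    exact hx
  have hsep : ∀ x y : Const × List L.kb.cl, ∃ C : Concept, C.sig ⊆ L.kb.sig ∧
      (x ∈ X → y ∈ X → x ≠ y → ¬ (Node.tree x.1 x.2 ∈ C.ext F.str ↔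
        Node.tree y.1 y.2 ∈ C.ext F.str)) := by
    intro x y
    by_cases h : x ∈ X ∧ y ∈ X ∧ x ≠ y
    · obtain ⟨C, hC, hC'⟩ := Frame.exists_concept_of_ne (F := F) hbound hF h.1.2 h.2.1.2 h.2.2
      exact ⟨C, hC, fun _ _ _ => hC'⟩
    · exact ⟨.top, Set.empty_subset _, fun h1 h2 h3 => absurd ⟨h1, h2, h3⟩ h⟩
  choose S hS hS' using hsep
  -- Only finitely many nodes can serve as images, so their pairwise separators can be added to
  -- `cl(K)` and the set stays finite.
  obtain ⟨U, hU, hUS, hsim⟩ := exists_finite_agree_simTo.{u} (S := L.kb.sig) L.kb.finite_sig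
    (T := L.kb.cl ∪ Set.image2 S X X) (L.kb.finite_cl.union (hXfin.image2 S hXfin)) (by
      rintro C (hC | ⟨x, -, y, -, rfl⟩)
      · exact KB.sig_subset_of_mem_cl hC
      · exact hS x y) (m + 1)
  obtain ⟨Y, hYS, hY⟩ := exists_char.{u} hU hUS fun C => Node.tree b [] ∈ C.ext F.str
  refine ⟨.neg Y, hYS, fun a ha B hB hBY => ?_, fun b' hb' hent => ?_⟩
  · refine hhom a ha (Frame.homTo_of_simTo (F := F) Set.subset_union_left ?_ hB
      (L.pos_subset ha) hbD hgood (Nat.lt_succ_self _) (hdist a (L.pos_subset ha))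
      (hsim _ _ _ _ ((hY _ _).1 hBY)))
    intro c w c' w' hc hc' hw hw' hg hg' hagree
    by_contra hne
    have hx : (c, w) ∈ X := ⟨⟨hc, hw⟩, hg⟩
    have hy : (c', w') ∈ X := ⟨⟨hc', hw'⟩, hg'⟩
    exact hS' _ _ hx hy hne (hagree _ (Or.inr ⟨_, hx, _, hy, rfl⟩))
  · rw [hb] at hb'
    obtain rfl : b' = b := hb'
    exact hent F.toStruc F.toStruc_isModel ((hY _ _).2 fun _ _ => Iff.rfl)

end ALCI

theorem mainTheorem4 (L : ALCI.LabeledKB) (b : ALCI.Const) (hb : L.neg = {b}) :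
    ALCI.LabeledKB.NonProjectivelySeparable.{u} L ↔
      ∃ A : ALCI.Struc.{u}, A.IsModel L.kb ∧ ∀ a ∈ L.pos,
        ¬ (L.kb.database.con a).HomTo a A.toRelStr (A.const b) ∧
        (ALCI.TypeConnected (L.kb.tp A.toRelStr (A.const b)) →
          ALCI.KB.TypeComplete.{u} L.kb (L.kb.tp A.toRelStr (A.const b)) →
          ¬ ALCI.KB.Realizable.{u} L.kb a (L.kb.tp A.toRelStr (A.const b))) := by
  constructor
  · rintro ⟨C, hC, hpos, hneg⟩
    have hnb := hneg b (hb ▸ rfl)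
    unfold ALCI.KB.Entails at hnb
    push Not at hnb
    obtain ⟨A, hA, hAC⟩ := hnb
    exact ⟨A, hA, fun a ha => ⟨ALCI.not_homTo_of_entails hA (hpos a ha) hAC,
      fun _ hcomp => ALCI.not_realizable_of_entails hA hC (hpos a ha) hAC hcomp⟩⟩
  · rintro ⟨A, hA, h⟩
    by_cases hconn : ALCI.TypeConnected (L.kb.tp A.toRelStr (A.const b))
    · by_cases hcomp : ALCI.KB.TypeComplete.{u} L.kb (L.kb.tp A.toRelStr (A.const b))
      · exact ALCI.separable_of_type_not_realizable L hA hb fun a ha => (h a ha).2 hconn hcomp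
      · exact ALCI.separable_of_not_typeComplete L hA hb (fun a ha => (h a ha).1) hconn hcomp
    -- Without connectedness, a realization at `a` itself yields the homomorphism that condition 1
    -- excludes.
    · refine ALCI.separable_of_type_not_realizable L hA hb fun a ha => ?_
      rintro ⟨B, hB, htp⟩
      exact (h a ha).1 (ALCI.homTo_of_not_typeConnected hB (L.pos_subset ha) htp hconn)
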